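/- Let $n\ge 0$, let $\mathfrak S_n$ be the group of permutations of $[n]=\{1,\dots,n\}$ with its Bruhat order $\le$, let $\ell(v)$ be the number of inversions of $v$, and let $t_{p,q}$ be the transposition of $p$ and $q$. For $v\le w$ the Bruhat interval polytope $\mathsf Q_{v,w}\subset\mathbb R^n$ is the convex hull of the points $(z(1),\dots,z(n))$ with $v\le z\le w$. Fix $w\in\mathfrak S_n$ and $u\le w$, put $\bar u=(u^{-1}(1),\dots,u^{-1}(n))$ (the vertices of $\mathsf Q_{id,w^{-1}}$ are exactly the points $\bar u$ with $u\le w$), and let $$\widetilde E_w(u)=\{(u(i),u(j))\mid i<j,\ t_{u(i),u(j)}u\le w,\ |\ell(u)-\ell(t_{u(i),u(j)}u)|=1\}.$$ This is the edge set of an acyclic digraph on $[n]$. Let $E_w(u)$ be the edge set of its transitive reduction, that is, the set of those $(p,q)\in\widetilde E_w(u)$ for which no directed path from $p$ to $q$ passes through a third vertex, and let $E_w(u)^+=\{(p,q)\in E_w(u)\mid p<q\}$. Let $\Gamma_w(u)^+$ be the graph with vertices $1,\dots,n$ in which $i$ and $j$ are joined if and only if $(u(i),u(j))$ or $(u(j),u(i))$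 lies in $E_w(u)^+$; its connected components are the maximal ascents (they correspond to the maximal ascending paths of $E_w(u)^+$). **Proposition 4.5.** The point $\bar u$ is a vertex of $\mathsf Q_{id,w^{-1}}$, and there is an injective real-valued function $f$ on the set of maximal ascents (equivalently, a total order on this set together with a strictly increasing function for that order) such that $f(I)>f(I')$ whenever there are $i\in I$ and $i'\in I'$ with $i<i'$ and $u(i)>u(i')$, and such that the following holds. Let $F(x)=\sum_{i=1}^n f(I_i)\,x_{u(i)}$, where $I_i$ is the maximal ascent that contains $i$. Then $F(x)\ge F(\bar u)$ for all $x\in \mathsf Q_{id,w^{-1}}$; the set $$G=\{x\in\mathsf Q_{id,w^{-1}}\mid F(x)=F(\bar u)\}$$ is a face of $\mathsf Q_{id,w^{-1}}$ that contains $\bar u$; and for every $a\in\mathbb R^n$ with $a_1>a_2>\dots>a_n$, with $h(x)=\langle a,x\rangle$, the edges of $G$ that contain $\bar u$ are exactly the edges of $\mathsf Q_{id,w^{-1}}$ that join $\bar u$ to a vertex $\bar v$ with $h(\bar u)<h(\bar v)$ (the $h$-ascending edges at $\bar u$). -/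

import Mathlib

namespace BruhatPolytope

open Equiv

/-- The length of a permutation: its number of inversions. -/
def len {n : ℕ} (u : Perm (Fin n)) : ℕ :=
  (Finset.univ.filter fun p : Fin n × Fin n => p.1 < p.2 ∧ u p.2 < u p.1).card

/-- The Bruhat order on the symmetric group: `v ≤ w` when `w` is reached from `v` by successive
multiplications by transpositions, each of which increases the length. -/
def bruhatLE {n : ℕ} (v w : Perm (Fin n)) : Prop :=
  Relation.ReflTransGen
    (fun x y : Perm (Fin n) => ∃ i j : Fin n, i ≠ j ∧ y = x * swap i j ∧ len x < len y) v w

/-- The point `(z(1), …, z(n))` of `ℝⁿ` (`Fin n` is `{0, …, n-1}`, whence the shift by one). -/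
def permPoint {n : ℕ} (z : Perm (Fin n)) : Fin n → ℝ := fun k => ((z k : ℕ) : ℝ) + 1

/-- The Bruhat interval polytope `Q_{v,w}`. -/
def bruhatPolytope {n : ℕ} (v w : Perm (Fin n)) : Set (Fin n → ℝ) :=
  convexHull ℝ (permPoint '' {z : Perm (Fin n) | bruhatLE v z ∧ bruhatLE z w})

/-- The point `ū = (u⁻¹(1), …, u⁻¹(n))`. -/
def ubar {n : ℕ} (u : Perm (Fin n)) : Fin n → ℝ := permPoint u⁻¹

/-- An edge of a polytope `P`: a one-dimensional face of `P`. -/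
def IsEdge {n : ℕ} (P e : Set (Fin n → ℝ)) : Prop :=
  IsExposed ℝ P e ∧ Module.finrank ℝ (vectorSpan ℝ e) = 1

/-- The edges of `P` emanating from `x` that ascend with respect to `h`: the edges of `P` that join
`x` to a point `y` (necessarily a vertex of `P`) with `h x < h y`. -/
def ascendingEdges {n : ℕ} (h : (Fin n → ℝ) → ℝ) (P : Set (Fin n → ℝ)) (x : Fin n → ℝ) :
    Set (Set (Fin n → ℝ)) :=
  {e | IsEdge P e ∧ ∃ y, e = segment ℝ x y ∧ h x < h y}

/-- The edges of the digraph `G_u^{e,w}` on `[n]`: the set `Ẽ_w(u)` of the pairs `(u(i), u(j))`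
with `i < j`, `t_{u(i),u(j)} u ≤ w` and `|ℓ(u) - ℓ(t_{u(i),u(j)} u)| = 1`. -/
def etilde {n : ℕ} (w u : Perm (Fin n)) (p q : Fin n) : Prop :=
  ∃ i j : Fin n, i < j ∧ p = u i ∧ q = u j ∧ bruhatLE (swap (u i) (u j) * u) w ∧
    |(len u : ℤ) - (len (swap (u i) (u j) * u) : ℤ)| = 1

/-- The transitive reduction of an acyclic digraph `R`: the edges `(p, q)` of `R` for which no
directed path from `p` to `q` passes through an intermediate vertex. -/
def transRed {V : Type*} (R : V → V → Prop) (p q : V) : Prop :=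
  R p q ∧ ¬ ∃ r, Relation.TransGen R p r ∧ Relation.TransGen R r q

/-- On a finite acyclic digraph, `transRed R` has the same reachability relation as `R`. -/
theorem transGen_transRed_iff {V : Type*} [Finite V] (R : V → V → Prop)
    (hR : ∀ x, ¬ Relation.TransGen R x x) (p q : V) :
    Relation.TransGen (transRed R) p q ↔ Relation.TransGen R p q := by
  constructor
  · intro h
    induction h with
    | single h => exact .single h.1
    | tail _ h ih => exact ih.tail h.1
  · suffices H : ∀ (k : ℕ) (p q : V),
        {r | Relation.TransGen R p r ∧ Relation.TransGen R r q}.ncard < k →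
        Relation.TransGen R p q → Relation.TransGen (transRed R) p q from
      H _ p q (Nat.lt_succ_self _)
    intro k
    induction k with
    | zero => intro p q h; omega
    | succ k ih =>
      intro p q hk hpq
      by_cases hr : ∃ r, Relation.TransGen R p r ∧ Relation.TransGen R r q
      · obtain ⟨r, h1, h2⟩ := hr
        refine (ih p r ?_ h1).trans (ih r q ?_ h2)
        · refine lt_of_lt_of_le (Set.ncard_lt_ncard ?_ (Set.toFinite _)) (Nat.lt_succ_iff.mp hk)
          refine ⟨fun s hs => ⟨hs.1, hs.2.trans h2⟩, fun hs => hR r (hs ⟨h1, h2⟩).2⟩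
        · refine lt_of_lt_of_le (Set.ncard_lt_ncard ?_ (Set.toFinite _)) (Nat.lt_succ_iff.mp hk)
          refine ⟨fun s hs => ⟨h1.trans hs.1, hs.2⟩, fun hs => hR r (hs ⟨h1, h2⟩).1⟩
      · cases hpq with
        | single h => exact .single ⟨h, hr⟩
        | tail h h' => exact absurd ⟨_, h, .single h'⟩ hr

/-- `transRed R` is contained in every digraph with the same reachability relation as `R`. -/
theorem transRed_le {V : Type*} (R S : V → V → Prop)
    (hS : ∀ x y, Relation.TransGen S x y ↔ Relation.TransGen R x y) (p q : V)
    (h : transRed R p q) : S p q := by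
  cases (hS p q).mpr (.single h.1) with
  | single h => exact h
  | tail h1 h2 => exact absurd ⟨_, (hS _ _).mp h1, (hS _ _).mp (.single h2)⟩ h.2

/-- The set `E_w(u)`: the edges of the transitive reduction of `G_u^{e,w}`. -/
def eset {n : ℕ} (w u : Perm (Fin n)) : Fin n → Fin n → Prop := transRed (etilde w u)

/-- The set `E_w(u)⁺` of the pairs `(p, q)` in `E_w(u)` with `p < q`. -/
def eplus {n : ℕ} (w u : Perm (Fin n)) (p q : Fin n) : Prop := eset w u p q ∧ p < q

/-- The graph `Γ_w(u)⁺` on the positions `1, …, n`, in which `i` and `j` are joined when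
`(u(i), u(j))` or `(u(j), u(i))` is in `E_w(u)⁺`. Its connected components are the maximal
ascents, that is, they correspond to the maximal ascending paths of `E_w(u)⁺`. -/
def ascGraph {n : ℕ} (w u : Perm (Fin n)) : SimpleGraph (Fin n) :=
  SimpleGraph.fromRel fun i j => eplus w u (u i) (u j)

/-- The maximal ascent to which the position `i` belongs. -/
def ascentOf {n : ℕ} (w u : Perm (Fin n)) (i : Fin n) : (ascGraph w u).ConnectedComponent :=
  (ascGraph w u).connectedComponentMk i

/-- The linear functional `F` on `ℝⁿ` that a function `f` on the set of maximal ascents defines: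
the inner product with the vector whose `k`-th coordinate, `k = u(i)`, is the value of `f` at the
maximal ascent of `i`. -/
noncomputable def pathFunctional {n : ℕ} (w u : Perm (Fin n))
    (f : (ascGraph w u).ConnectedComponent → ℝ) (x : Fin n → ℝ) : ℝ :=
  ∑ k, f (ascentOf w u (u⁻¹ k)) * x k

end BruhatPolytope

open BruhatPolytope

namespace BruhatPolytope

open Equiv

variable {n : ℕ}

/-! Everything rests on two facts: the cone of the polytope at `ū` is generated by the vectors `e_p
- e_q` with `(p, q)` in `eset w u`, and some weight on the maximal ascents respects all inversions
of `u`.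

Cone. By the Ehresmann criterion, `v ≤ w` is a comparison of the counts `cornerCount`. The vector
`v̄ - ū` is a sum over `k` of differences of the indicators of the first `k` values of `u` and of
`v`. A greedy exchange (`indVec_sub_mem`) writes each difference as a sum of `e_a - e_b` such that
no threshold at which `u` already attains the count of `w` separates `a` from `b`. For such a pair
`transGen_of_exchange` finds a path from `a` to `b` in `etilde w u`, hence in its transitive
reduction, and `e_a - e_b` telescopes along it.

Weight. In the transitive reduction the steps with `p < q` form disjoint chains, because two steps
sharing an end would make one of them redundant. The relation "`C` has a point to the left of and
higher than a point of `D`" on chains is acyclic (`ascentAbove_acyclic`): a chain whose top lies to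
the left of the tops of both its neighbours in a cycle can be bypassed. A linear extension gives
`f`.

Then `F` vanishes on the generators with `p < q` and is positive on those with `q < p`. So `F` is
minimal at `ū`, and `G` contains just those edges at `ū` whose direction has `p < q`. Since `⟨a, e_p
- e_q⟩ = a_p - a_q` and `a` decreases, these are the ascending edges. -/

/-! ### Length under a transposition. -/

theorem sum_univ_eq_add_add_sum {M : Type*} [AddCommMonoid M] {i j : Fin n} (hij : i ≠ j)
    (g : Fin n → M) :
    ∑ q, g q = g i + (g j + ∑ q with q ≠ i ∧ q ≠ j, g q) := by
  have h : (Finset.univ : Finset (Fin n)) =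
      insert i (insert j (Finset.univ.filter fun q => q ≠ i ∧ q ≠ j)) := by
    ext q; simp; tauto
  conv_lhs => rw [h]
  rw [Finset.sum_insert (by simp [hij]), Finset.sum_insert (by simp)]

theorem len_eq_sum (u : Perm (Fin n)) :
    (len u : ℤ) = ∑ p, ∑ q, if p < q ∧ u q < u p then 1 else 0 := by
  rw [len, Finset.card_filter, ← Finset.univ_product_univ, Finset.sum_product]
  push_cast
  rfl

theorem len_mul_swap (u : Perm (Fin n)) {i j : Fin n} (hij : i < j) (hu : u i < u j) :
    len (u * swap i j) = len u + 1 +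
      2 * (Finset.univ.filter fun m => i < m ∧ m < j ∧ u i < u m ∧ u m < u j).card := by
  set s := swap i j with hs
  have hss : ∀ q, s (s q) = q := fun q => swap_apply_self i j q
  -- Reindexing both sums by `s` moves the swap from the values to the positions, so terms with `p`
  -- and `q` both outside `{i, j}` cancel in the difference of lengths.
  have e1 : (len (u * s) : ℤ) = ∑ p, ∑ q, if s p < s q ∧ u q < u p then 1 else 0 := by
    rw [len_eq_sum, ← Equiv.sum_comp s]
    refine Finset.sum_congr rfl fun p _ => ?_
    rw [← Equiv.sum_comp s]
    simp [hss]
  have hi : s i = j := swap_apply_left i j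
  have hj : s j = i := swap_apply_right i j
  have hm : ∀ m, m ≠ i ∧ m ≠ j → s m = m := fun m h => swap_apply_of_ne_of_ne h.1 h.2
  suffices h : (len (u * s) : ℤ) - len u = 1 +
      2 * (Finset.univ.filter fun m => i < m ∧ m < j ∧ u i < u m ∧ u m < u j).card by omega
  rw [e1, len_eq_sum, ← Finset.sum_sub_distrib]
  simp_rw [← Finset.sum_sub_distrib]
  set d : Fin n → Fin n → ℤ := fun p q =>
    (if s p < s q ∧ u q < u p then 1 else 0) - (if p < q ∧ u q < u p then 1 else 0) with hd
  change ∑ p, ∑ q, d p q = _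
  rw [sum_univ_eq_add_add_sum hij.ne]
  simp_rw [sum_univ_eq_add_add_sum hij.ne (d _)]
  have h0 : ∀ p ∈ Finset.univ.filter (fun p => p ≠ i ∧ p ≠ j),
      d p i + (d p j + ∑ q with q ≠ i ∧ q ≠ j, d p q) = d p i + d p j := by
    intro p hp
    rw [Finset.sum_eq_zero, add_zero]
    intro q hq
    simp only [Finset.mem_filter, Finset.mem_univ, true_and] at hp hq
    simp [hd, hm p hp, hm q hq]
  rw [Finset.sum_congr rfl h0]
  have h1 : d i i = 0 := by simp [hd]
  have h2 : d j j = 0 := by simp [hd]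
  have h3 : d i j = 0 := by simp [hd, hi, hj, hu.not_gt]
  have h4 : d j i = 1 := by simp [hd, hi, hj, hu, hij, hij.not_gt]
  have h5 : ∑ m with m ≠ i ∧ m ≠ j, (d i m + d j m + (d m i + d m j)) =
      2 * (Finset.univ.filter fun m => i < m ∧ m < j ∧ u i < u m ∧ u m < u j).card := by
    rw [Finset.card_filter, Nat.cast_sum, Finset.mul_sum, Finset.sum_filter]
    refine Finset.sum_congr rfl fun m _ => ?_
    by_cases h : m ≠ i ∧ m ≠ j
    · have hui : u m ≠ u i := fun h' => h.1 (u.injective h')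
      have huj : u m ≠ u j := fun h' => h.2 (u.injective h')
      rw [if_pos h]
      simp only [hd, hi, hj, hm m h]
      have g1 : m < i ↔ ¬ i < m :=
        ⟨fun h' => h'.not_gt, fun h' => lt_of_le_of_ne (not_lt.mp h') h.1⟩
      have g2 : j < m ↔ ¬ m < j :=
        ⟨fun h' => h'.not_gt, fun h' => lt_of_le_of_ne (not_lt.mp h') h.2.symm⟩
      have g3 : u m < u i ↔ ¬ u i < u m :=
        ⟨fun h' => h'.not_gt, fun h' => lt_of_le_of_ne (not_lt.mp h') hui⟩
      have g4 : u j < u m ↔ ¬ u m < u j :=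
        ⟨fun h' => h'.not_gt, fun h' => lt_of_le_of_ne (not_lt.mp h') huj.symm⟩
      have g5 : ¬ i < m → m < j := fun h' => (g1.mpr h').trans hij
      have g6 : ¬ u i < u m → u m < u j := fun h' => (g3.mpr h').trans hu
      simp only [g1, g2, g3, g4]
      clear_value s d
      clear hs hss e1 hi hj hm h1 h2 h3 h4 h0 hd g1 g2 g3 g4
      by_cases k1 : i < m <;> by_cases k2 : m < j <;> by_cases k3 : u i < u m <;>
        by_cases k4 : u m < u j <;>
        first
        | exact absurd (g5 k1) k2
        | exact absurd (g6 k3) k4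
        | (simp only [k1, k2, k3, k4]; norm_num)
    · rw [if_neg h, if_neg]
      · simp
      · rintro ⟨a, b, -⟩
        exact h ⟨a.ne', b.ne⟩
  rw [Finset.sum_add_distrib, Finset.sum_add_distrib] at h5
  linarith

theorem lt_of_len_lt {u : Perm (Fin n)} {i j : Fin n} (hij : i < j)
    (h : len u < len (u * swap i j)) : u i < u j := by
  by_contra hu
  have hu' : (u * swap i j) i < (u * swap i j) j := by
    simpa using lt_of_le_of_ne (not_lt.mp hu) (fun e => hij.ne' (u.injective e))
  have := len_mul_swap (u * swap i j) hij hu'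
  rw [mul_assoc, swap_mul_self, mul_one] at this
  omega

/-! ### Corner counts and the Ehresmann criterion. -/

/-- The number of `i < k` with `x ≤ u i`. -/
def cornerCount (u : Perm (Fin n)) (k x : ℕ) : ℕ :=
  (Finset.univ.filter fun i : Fin n => (i : ℕ) < k ∧ x ≤ (u i : ℕ)).card

/-- The number of `i < k` with `x ≤ u i < y`. -/
def bandCount (u : Perm (Fin n)) (k x y : ℕ) : ℕ :=
  (Finset.univ.filter fun i : Fin n => (i : ℕ) < k ∧ x ≤ (u i : ℕ) ∧ (u i : ℕ) < y).card

theorem cornerCount_eq_add (u : Perm (Fin n)) (k : ℕ) {x y : ℕ} (h : x ≤ y) :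
    cornerCount u k x = bandCount u k x y + cornerCount u k y := by
  rw [cornerCount, bandCount, cornerCount, ← Finset.card_union_of_disjoint]
  · congr 1
    ext l
    simp only [Finset.mem_filter, Finset.mem_univ, true_and, Finset.mem_union]
    omega
  · rw [Finset.disjoint_left]
    intro l
    simp only [Finset.mem_filter, Finset.mem_univ, true_and]
    omega

theorem bandCount_mono (u : Perm (Fin n)) {k m : ℕ} (h : k ≤ m) (x y : ℕ) :
    bandCount u k x y ≤ bandCount u m x y := by
  refine Finset.card_le_card fun l => ?_
  simp only [Finset.mem_filter, Finset.mem_univ, true_and]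
  omega

theorem exists_of_bandCount_lt {u : Perm (Fin n)} {m k x y : ℕ}
    (h : bandCount u m x y < bandCount u k x y) :
    ∃ l : Fin n, m ≤ (l : ℕ) ∧ (l : ℕ) < k ∧ x ≤ (u l : ℕ) ∧ (u l : ℕ) < y := by
  by_contra! hc
  refine h.not_ge (Finset.card_le_card fun l => ?_)
  simp only [Finset.mem_filter, Finset.mem_univ, true_and]
  rintro ⟨h1, h2, h3⟩
  refine ⟨?_, h2, h3⟩
  by_contra h4
  exact absurd (hc l (not_lt.mp h4) h1 h2) (not_le.mpr h3)

theorem cornerCount_zero_right (u : Perm (Fin n)) (k : ℕ) :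
    cornerCount u k 0 = (Finset.univ.filter fun i : Fin n => (i : ℕ) < k).card := by
  simp [cornerCount]

theorem cornerCount_top (u : Perm (Fin n)) (k : ℕ) : cornerCount u k n = 0 := by
  rw [cornerCount, Finset.card_eq_zero, Finset.filter_eq_empty_iff]
  intro i _
  have := (u i).isLt
  omega

theorem cornerCount_mul_swap (u : Perm (Fin n)) {i j : Fin n} (hij : i < j) (hu : u i < u j)
    (k x : ℕ) : cornerCount (u * swap i j) k x = cornerCount u k x +
      if (i : ℕ) < k ∧ k ≤ j ∧ (u i : ℕ) < x ∧ x ≤ u j then 1 else 0 := by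
  have h0 : ∀ v : Perm (Fin n), cornerCount v k x =
      ∑ l : Fin n, if (l : ℕ) < k ∧ x ≤ (v l : ℕ) then 1 else 0 := fun v => by
    rw [cornerCount, Finset.card_filter]
  rw [h0, h0, sum_univ_eq_add_add_sum hij.ne, sum_univ_eq_add_add_sum hij.ne]
  have h1 : ∑ l with l ≠ i ∧ l ≠ j, (if (l : ℕ) < k ∧ x ≤ ((u * swap i j) l : ℕ) then 1 else 0) =
      ∑ l with l ≠ i ∧ l ≠ j, (if (l : ℕ) < k ∧ x ≤ (u l : ℕ) then 1 else 0) := by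
    refine Finset.sum_congr rfl fun l hl => ?_
    simp only [Finset.mem_filter, Finset.mem_univ, true_and] at hl
    rw [Perm.mul_apply, swap_apply_of_ne_of_ne hl.1 hl.2]
  rw [h1]
  simp only [Perm.mul_apply, swap_apply_left, swap_apply_right]
  simp only [Fin.lt_def] at hij hu
  split_ifs <;> omega

theorem cornerCount_le_of_bruhatLE {v w : Perm (Fin n)} (h : bruhatLE v w) (k x : ℕ) :
    cornerCount v k x ≤ cornerCount w k x := by
  induction h with
  | refl => exact le_rfl
  | @tail y z _ h ih =>
    refine ih.trans ?_
    obtain ⟨i, j, hij, rfl, hl⟩ := h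
    rcases lt_or_gt_of_ne hij with h | h
    · rw [cornerCount_mul_swap y h (lt_of_len_lt h hl)]
      omega
    · rw [swap_comm] at hl ⊢
      rw [cornerCount_mul_swap y h (lt_of_len_lt h hl)]
      omega

theorem len_lt_mul_swap {u : Perm (Fin n)} {i j : Fin n} (hij : i < j) (hu : u i < u j) :
    len u < len (u * swap i j) := by
  rw [len_mul_swap u hij hu]
  omega

/-- Take `i` as the first disagreement, where necessarily `v i < w i`, and `j` as the first later
position with value in `(v i, w i]`. Where the swap raises the count, the values of `v` between `x`
and `w i` sit only at positions before `i`, where `v` and `w` agree, while `w` has the extra value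
`w i`. This leaves room for one more. -/
theorem exists_swap_of_cornerCount_le {v w : Perm (Fin n)}
    (h : ∀ k x, cornerCount v k x ≤ cornerCount w k x) (hne : v ≠ w) :
    ∃ i j : Fin n, i < j ∧ v i < v j ∧
      ∀ k x, cornerCount (v * swap i j) k x ≤ cornerCount w k x := by
  obtain ⟨i, hi, hmin⟩ : ∃ i, v i ≠ w i ∧ ∀ l < i, v l = w l := by
    have : {i | v i ≠ w i}.Nonempty := by
      by_contra hc
      rw [Set.not_nonempty_iff_eq_empty, Set.eq_empty_iff_forall_notMem] at hc
      exact hne (Equiv.ext fun i => by simpa using hc i)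
    obtain ⟨i, hi, hm⟩ := WellFounded.has_min (wellFounded_lt (α := Fin n)) _ this
    exact ⟨i, hi, fun l hl => by_contra fun hc => hm l hc hl⟩
  have hvw : v i < w i := by
    rcases lt_or_gt_of_ne hi with h1 | h1
    · exact h1
    · exfalso
      refine (h (i + 1) (v i)).not_gt (Finset.card_lt_card ?_)
      rw [Finset.ssubset_iff_of_subset]
      · exact ⟨i, by simp, by simpa using h1⟩
      · intro l
        simp only [Finset.mem_filter, Finset.mem_univ, true_and, Fin.lt_def] at *
        rintro ⟨h2, h3⟩
        rcases eq_or_lt_of_le (Nat.lt_succ_iff.mp h2) with h4 | h4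
        · obtain rfl : l = i := Fin.ext h4
          omega
        · rw [hmin l h4]
          exact ⟨h2, h3⟩
  have hvv : ∀ x, v (v⁻¹ x) = x := fun x => by simp
  obtain ⟨j, ⟨hij, hj1, hj2⟩, hjm⟩ :
      ∃ j, (i < j ∧ v i < v j ∧ v j ≤ w i) ∧ ∀ l < j, ¬ (i < l ∧ v i < v l ∧ v l ≤ w i) := by
    have : {j | i < j ∧ v i < v j ∧ v j ≤ w i}.Nonempty := by
      refine ⟨v⁻¹ (w i), ?_, by simpa using hvw, by simp⟩
      by_contra hc
      rcases eq_or_lt_of_le (not_lt.mp hc) with h1 | h1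
      · have : v (v⁻¹ (w i)) = v i := by rw [h1]
        rw [hvv] at this
        exact hi this.symm
      · have h2 := hmin _ h1
        rw [hvv] at h2
        exact h1.ne (w.injective h2.symm)
    obtain ⟨i, hi, hm⟩ := WellFounded.has_min (wellFounded_lt (α := Fin n)) _ this
    exact ⟨i, hi, fun l hl hc => hm l hc hl⟩
  refine ⟨i, j, hij, hj1, fun k x => ?_⟩
  rw [cornerCount_mul_swap v hij hj1]
  split_ifs with hr
  · obtain ⟨h1, h2, h3, h4⟩ := hr
    have hx : x ≤ (w i : ℕ) + 1 := by
      simp only [Fin.le_def] at hj2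
      omega
    rw [cornerCount_eq_add v k hx, cornerCount_eq_add w k hx]
    have := h k ((w i : ℕ) + 1)
    have : bandCount v k x ((w i : ℕ) + 1) < bandCount w k x ((w i : ℕ) + 1) := by
      refine Finset.card_lt_card ?_
      rw [Finset.ssubset_iff_of_subset]
      · refine ⟨i, ?_, ?_⟩
        · simp only [Finset.mem_filter, Finset.mem_univ, true_and, Fin.le_def] at *
          omega
        · simp only [Finset.mem_filter, Finset.mem_univ, true_and]
          omega
      · intro l
        simp only [Finset.mem_filter, Finset.mem_univ, true_and]
        rintro ⟨h5, h6, h7⟩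
        rcases lt_trichotomy l i with h8 | h8 | h8
        · rw [← hmin l h8]
          exact ⟨h5, h6, h7⟩
        · subst h8
          omega
        · exfalso
          refine hjm l ?_ ⟨h8, ?_, ?_⟩ <;> simp only [Fin.lt_def, Fin.le_def] <;> omega
    omega
  · simpa using h k x

theorem len_le (u : Perm (Fin n)) : len u ≤ n * n :=
  (Finset.card_filter_le _ _).trans (by simp)

/-- The Ehresmann criterion for the Bruhat order. -/
theorem bruhatLE_iff_cornerCount_le {v w : Perm (Fin n)} :
    bruhatLE v w ↔ ∀ k x, cornerCount v k x ≤ cornerCount w k x := by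
  refine ⟨cornerCount_le_of_bruhatLE, ?_⟩
  suffices H : ∀ (d : ℕ) (v : Perm (Fin n)), n * n - len v ≤ d →
      (∀ k x, cornerCount v k x ≤ cornerCount w k x) → bruhatLE v w from H _ v le_rfl
  intro d
  induction d with
  | zero =>
    intro v hd h
    by_cases hne : v = w
    · exact hne ▸ .refl
    obtain ⟨i, j, hij, hu, -⟩ := exists_swap_of_cornerCount_le h hne
    have h1 := len_lt_mul_swap hij hu
    have h2 := len_le (v * swap i j)
    omega
  | succ d ih =>
    intro v hd h
    by_cases hne : v = w
    · exact hne ▸ .refl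
    obtain ⟨i, j, hij, hu, h'⟩ := exists_swap_of_cornerCount_le h hne
    have h1 := len_lt_mul_swap hij hu
    have h2 := len_le (v * swap i j)
    exact .head ⟨i, j, hij.ne, rfl, h1⟩ (ih _ (by omega) h')

/-- Among its first `k` values the identity has as many values below `x` as a permutation can have,
hence as few as possible from `x` on. -/
theorem one_bruhatLE (z : Perm (Fin n)) : bruhatLE 1 z := by
  rw [bruhatLE_iff_cornerCount_le]
  intro k x
  have h1 : cornerCount (1 : Perm (Fin n)) k x + bandCount (1 : Perm (Fin n)) k 0 x =
      cornerCount z k x + bandCount z k 0 x := by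
    rw [add_comm, ← cornerCount_eq_add _ _ (Nat.zero_le x), add_comm,
      ← cornerCount_eq_add _ _ (Nat.zero_le x), cornerCount_zero_right, cornerCount_zero_right]
  by_cases hxk : x ≤ k
  · have h2 : bandCount z k 0 x ≤ bandCount (1 : Perm (Fin n)) k 0 x := by
      rw [bandCount, bandCount]
      refine Finset.card_le_card_of_injOn z ?_ z.injective.injOn
      intro l hl
      obtain ⟨-, h2, h3, h4⟩ := Finset.mem_filter.mp (Finset.mem_coe.mp hl)
      exact Finset.mem_coe.mpr (Finset.mem_filter.mpr
        ⟨Finset.mem_univ _, by simp only [Perm.one_apply]; omega⟩)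
    omega
  · have : cornerCount (1 : Perm (Fin n)) k x = 0 := by
      rw [cornerCount, Finset.card_eq_zero, Finset.filter_eq_empty_iff]
      intro i _
      simp only [Perm.one_apply]
      omega
    omega

theorem len_inv (u : Perm (Fin n)) : len u⁻¹ = len u := by
  suffices H : ∀ u : Perm (Fin n), len u ≤ len u⁻¹ from
    le_antisymm (by simpa using H u⁻¹) (H u)
  intro u
  refine Finset.card_le_card_of_injOn (fun p => (u p.2, u p.1)) ?_ ?_
  · rintro ⟨p, q⟩
    simp
    tauto
  · rintro ⟨p, q⟩ - ⟨p', q'⟩ -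
    simp
    tauto

theorem bruhatLE.inv {v w : Perm (Fin n)} (h : bruhatLE v w) : bruhatLE v⁻¹ w⁻¹ := by
  refine Relation.ReflTransGen.lift (fun x : Perm (Fin n) => x⁻¹) ?_ _ _ h
  rintro x y ⟨i, j, hij, rfl, hl⟩
  refine ⟨x i, x j, fun h => hij (x.injective h), ?_, by simpa only [len_inv] using hl⟩
  simp only
  rw [mul_inv_rev, swap_inv, mul_swap_eq_swap_mul]
  simp

theorem len_mul_swap_of_empty {u : Perm (Fin n)} {i j : Fin n} (hij : i < j) (hu : u i < u j)
    (he : ∀ m, i < m → m < j → u i < u m → ¬ u m < u j) : len (u * swap i j) = len u + 1 := by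
  have h0 : (Finset.univ.filter fun m => i < m ∧ m < j ∧ u i < u m ∧ u m < u j) = ∅ :=
    Finset.filter_eq_empty_iff.mpr fun m _ ⟨h1, h2, h3, h4⟩ => he m h1 h2 h3 h4
  rw [len_mul_swap u hij hu, h0]
  simp

/-! ### Paths in the digraph `etilde w u`. -/

theorem etilde_iff {w u : Perm (Fin n)} {i j : Fin n} :
    etilde w u (u i) (u j) ↔ i < j ∧ bruhatLE (u * swap i j) w ∧
      |(len u : ℤ) - (len (u * swap i j) : ℤ)| = 1 := by
  constructor
  · rintro ⟨i', j', hij, hi, hj, h⟩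
    obtain rfl := u.injective hi
    obtain rfl := u.injective hj
    rw [← mul_swap_eq_swap_mul] at h
    exact ⟨hij, h⟩
  · rintro ⟨hij, h⟩
    refine ⟨i, j, hij, rfl, rfl, ?_⟩
    rwa [← mul_swap_eq_swap_mul]

theorem lt_of_etilde {w u : Perm (Fin n)} {p q : Fin n} (h : etilde w u p q) :
    u⁻¹ p < u⁻¹ q := by
  obtain ⟨i, j, hij, rfl, rfl, -⟩ := h
  simpa using hij

theorem lt_of_transGen_etilde {w u : Perm (Fin n)} {p q : Fin n}
    (h : Relation.TransGen (etilde w u) p q) : u⁻¹ p < u⁻¹ q := by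
  induction h with
  | single h => exact lt_of_etilde h
  | tail _ h ih => exact ih.trans (lt_of_etilde h)

theorem etilde_acyclic (w u : Perm (Fin n)) (p : Fin n) :
    ¬ Relation.TransGen (etilde w u) p p := fun h => (lt_of_transGen_etilde h).false

/-- The rectangle spanned by an ascending edge contains no further point of the permutation. -/
theorem not_lt_of_etilde {w u : Perm (Fin n)} {i j : Fin n} (h : etilde w u (u i) (u j))
    (hu : u i < u j) {m : Fin n} (h1 : i < m) (h2 : m < j) (h3 : u i < u m) : ¬ u m < u j := by
  intro h4
  obtain ⟨hij, -, hl⟩ := etilde_iff.mp h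
  rw [len_mul_swap u hij hu] at hl
  have : 0 < (Finset.univ.filter fun m => i < m ∧ m < j ∧ u i < u m ∧ u m < u j).card :=
    Finset.card_pos.mpr ⟨m, by simp [*]⟩
  have hl2 : (len u : ℤ) - ((len u + 1 +
      2 * (Finset.univ.filter fun m => i < m ∧ m < j ∧ u i < u m ∧ u m < u j).card : ℕ) : ℤ) <
      0 := by
    omega
  rw [abs_of_neg hl2] at hl
  omega

theorem etilde_of_ascent {w u : Perm (Fin n)} {i j : Fin n} (hij : i < j) (hu : u i < u j)
    (he : ∀ m, i < m → m < j → u i < u m → ¬ u m < u j) (h : bruhatLE (u * swap i j) w) :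
    etilde w u (u i) (u j) := by
  refine etilde_iff.mpr ⟨hij, h, ?_⟩
  rw [len_mul_swap_of_empty hij hu he]
  push_cast
  norm_num

theorem etilde_of_inversion {w u : Perm (Fin n)} (huw : bruhatLE u w) {i j : Fin n} (hij : i < j)
    (hu : u j < u i) (he : ∀ m, i < m → m < j → u j < u m → ¬ u m < u i) :
    etilde w u (u i) (u j) := by
  have hu' : (u * swap i j) i < (u * swap i j) j := by simpa using hu
  have hl := len_mul_swap_of_empty hij hu' (fun m h1 h2 => by
    simpa [swap_apply_of_ne_of_ne h1.ne' h2.ne] using he m h1 h2)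
  rw [mul_assoc, swap_mul_self, mul_one] at hl
  refine etilde_iff.mpr ⟨hij, .trans (.single ⟨i, j, hij.ne, ?_, by omega⟩) huw, ?_⟩
  · rw [mul_assoc, swap_mul_self, mul_one]
  · rw [hl]
    push_cast
    norm_num

/-- Undoing an inversion goes down in Bruhat order, so the bound by `w` is automatic. Only the
length condition can fail, and then a point inside the rectangle splits the inversion into two
shorter ones. -/
theorem transGen_of_inversion {w u : Perm (Fin n)} (huw : bruhatLE u w) {i j : Fin n}
    (hij : i < j) (hu : u j < u i) : Relation.TransGen (etilde w u) (u i) (u j) := by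
  suffices H : ∀ (d : ℕ) (i j : Fin n), (j : ℕ) - i ≤ d → i < j → u j < u i →
      Relation.TransGen (etilde w u) (u i) (u j) from H _ i j le_rfl hij hu
  intro d
  induction d with
  | zero => intro i j hd hij; simp only [Fin.lt_def] at hij; omega
  | succ d ih =>
    intro i j hd hij hu
    by_cases he : ∀ m, i < m → m < j → u j < u m → ¬ u m < u i
    · exact .single (etilde_of_inversion huw hij hu he)
    · push Not at he
      obtain ⟨m, h1, h2, h3, h4⟩ := he
      have h1' := Fin.lt_def.mp h1
      have h2' := Fin.lt_def.mp h2
      exact (ih i m (by omega) h1 h4).trans (ih m j (by omega) h2 h3)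

/-- The swap raises the corner count by one exactly on this rectangle, so a positive defect there
keeps it below `w`. If the rectangle contains a point of `u`, split there. -/
theorem transGen_of_rectangle {w u : Perm (Fin n)} (huw : bruhatLE u w) {i j : Fin n}
    (hij : i < j) (hu : u i < u j)
    (h : ∀ k x : ℕ, (i : ℕ) < k → k ≤ j → (u i : ℕ) < x → x ≤ u j →
      cornerCount u k x < cornerCount w k x) :
    Relation.TransGen (etilde w u) (u i) (u j) := by
  suffices H : ∀ (d : ℕ) (i j : Fin n), (j : ℕ) - i ≤ d → i < j → u i < u j →
      (∀ k x : ℕ, (i : ℕ) < k → k ≤ j → (u i : ℕ) < x → x ≤ u j →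
        cornerCount u k x < cornerCount w k x) →
      Relation.TransGen (etilde w u) (u i) (u j) from H _ i j le_rfl hij hu h
  intro d
  induction d with
  | zero => intro i j hd hij; simp only [Fin.lt_def] at hij; omega
  | succ d ih =>
    intro i j hd hij hu h
    by_cases he : ∀ m, i < m → m < j → u i < u m → ¬ u m < u j
    · refine .single (etilde_of_ascent hij hu he ?_)
      rw [bruhatLE_iff_cornerCount_le]
      intro k x
      rw [cornerCount_mul_swap u hij hu]
      split_ifs with hr
      · exact h k x hr.1 hr.2.1 hr.2.2.1 hr.2.2.2
      · exact cornerCount_le_of_bruhatLE huw k x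
    · push Not at he
      obtain ⟨m, h1, h2, h3, h4⟩ := he
      have h1' := Fin.lt_def.mp h1
      have h2' := Fin.lt_def.mp h2
      have h3' := Fin.lt_def.mp h3
      have h4' := Fin.lt_def.mp h4
      exact (ih i m (by omega) h1 h3 fun k x a b c e => h k x a (by omega) c (by omega)).trans
        (ih m j (by omega) h2 h4 fun k x a b c e => h k x (by omega) b (by omega) e)

/-- If `u i` can be exchanged for `u j` in the set of the first `k` values of `u` without leaving
the lower set of the first `k` values of `w`, then `etilde w u` has a path from `u i` to `u j`. -/
theorem transGen_of_exchange {w u : Perm (Fin n)} (huw : bruhatLE u w) {i j : Fin n} {k : ℕ}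
    (hik : (i : ℕ) < k) (hkj : k ≤ j)
    (h : ∀ x : ℕ, (u i : ℕ) < x → x ≤ u j → cornerCount u k x < cornerCount w k x) :
    Relation.TransGen (etilde w u) (u i) (u j) := by
  have hN := cornerCount_le_of_bruhatLE huw
  suffices H : ∀ (d : ℕ) (i j : Fin n) (k : ℕ), (j : ℕ) - i ≤ d → (i : ℕ) < k → k ≤ j →
      (∀ x : ℕ, (u i : ℕ) < x → x ≤ u j → cornerCount u k x < cornerCount w k x) →
      Relation.TransGen (etilde w u) (u i) (u j) from H _ i j k le_rfl hik hkj h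
  clear hik hkj h
  intro d
  induction d with
  | zero => intro i j k hd h1 h2; omega
  | succ d ih =>
    intro i j k hd hik hkj h
    have hij : i < j := Fin.lt_def.mpr (by omega)
    rcases lt_or_gt_of_ne (fun e => hij.ne (u.injective e) : u i ≠ u j) with hu | hu
    swap
    · exact transGen_of_inversion huw hij hu
    by_cases hrect : ∀ m x : ℕ, (i : ℕ) < m → m ≤ j → (u i : ℕ) < x → x ≤ u j →
        cornerCount u m x < cornerCount w m x
    · exact transGen_of_rectangle huw hij hu hrect
    push Not at hrect
    obtain ⟨m, x, him, hmj, hix, hxj, hmx⟩ := hrect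
    rcases lt_trichotomy m k with hmk | rfl | hmk
    · -- a zero of the defect in a column to the left of `k`
      obtain ⟨x₀, ⟨hix₀, hx₀, hmx₀⟩, hmin⟩ : ∃ x₀ : ℕ, ((u i : ℕ) < x₀ ∧ x₀ ≤ x ∧
          cornerCount w m x₀ ≤ cornerCount u m x₀) ∧
          ∀ y < x₀, ¬ ((u i : ℕ) < y ∧ y ≤ x ∧ cornerCount w m y ≤ cornerCount u m y) := by
        classical
        have hex : ∃ x₀ : ℕ, (u i : ℕ) < x₀ ∧ x₀ ≤ x ∧ cornerCount w m x₀ ≤ cornerCount u m x₀ :=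
          ⟨x, hix, le_rfl, hmx⟩
        exact ⟨Nat.find hex, Nat.find_spec hex, fun y hy => Nat.find_min hex hy⟩
      -- The defect is the count of `w` minus that of `u`. Row `0` is a zero of the defect in every
      -- column, so a last zero at or below `u i` exists in column `k`.
      obtain ⟨y₁, hy₁, hky₁, hmax⟩ : ∃ y₁ ≤ (u i : ℕ), cornerCount w k y₁ ≤ cornerCount u k y₁ ∧
          ∀ y, y₁ < y → y ≤ u i → cornerCount u k y < cornerCount w k y := by
        classical
        have h0 : cornerCount w k 0 ≤ cornerCount u k 0 := by
          rw [cornerCount_zero_right, cornerCount_zero_right]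
        refine ⟨Nat.findGreatest (fun y => cornerCount w k y ≤ cornerCount u k y) (u i),
          Nat.findGreatest_le _, Nat.findGreatest_spec (P := fun y =>
            cornerCount w k y ≤ cornerCount u k y) (Nat.zero_le _) h0, fun y h1 h2 => ?_⟩
        exact not_le.mp (Nat.findGreatest_is_greatest (P := fun y =>
          cornerCount w k y ≤ cornerCount u k y) h1 h2)
      -- In column `k` the defect is zero at `y₁` and positive at `x₀`, so `u` has more points than
      -- `w` in the band. In column `m` it is zero at `x₀`, so `u` has at most as many as `w`. The
      -- surplus yields a point `l` of `u` between the columns, through which the path is routed.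
      have hband : bandCount u m y₁ x₀ < bandCount u k y₁ x₀ := by
        have hyx : y₁ ≤ x₀ := by omega
        have a1 := cornerCount_eq_add u m hyx
        have a2 := cornerCount_eq_add w m hyx
        have a3 := cornerCount_eq_add u k hyx
        have a4 := cornerCount_eq_add w k hyx
        have a5 := bandCount_mono w hmk.le y₁ x₀
        have a6 := hN m y₁
        have a7 := h x₀ hix₀ (by omega)
        omega
      obtain ⟨l, hl1, hl2, hl3, hl4⟩ := exists_of_bandCount_lt hband
      have hil : i < l := Fin.lt_def.mpr (by omega)
      have hright : Relation.TransGen (etilde w u) (u l) (u j) := by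
        refine ih l j k (by omega) hl2 hkj fun y h1 h2 => ?_
        rcases le_or_gt y (u i) with h3 | h3
        · exact hmax y (by omega) h3
        · exact h y h3 h2
      refine .trans ?_ hright
      rcases lt_or_gt_of_ne (fun e => hil.ne (u.injective e) : u i ≠ u l) with h1 | h1
      · refine ih i l m (by omega) him hl1 fun y h2 h3 => ?_
        by_contra hc
        exact hmin y (by omega) ⟨h2, by omega, not_lt.mp hc⟩
      · exact transGen_of_inversion huw hil h1
    · exact absurd (h x hix hxj) (not_lt.mpr hmx)
    · -- a zero of the defect in a column to the right of `k`
      obtain ⟨x₀, hxx₀, hx₀j, hmx₀, hmax⟩ : ∃ x₀ : ℕ, x ≤ x₀ ∧ x₀ ≤ u j ∧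
          cornerCount w m x₀ ≤ cornerCount u m x₀ ∧
          ∀ y, x₀ < y → y ≤ u j → cornerCount u m y < cornerCount w m y := by
        classical
        refine ⟨Nat.findGreatest (fun y => cornerCount w m y ≤ cornerCount u m y) (u j),
          Nat.le_findGreatest hxj hmx,
          Nat.findGreatest_le _, Nat.findGreatest_spec (P := fun y =>
            cornerCount w m y ≤ cornerCount u m y) hxj hmx, fun y h1 h2 => ?_⟩
        exact not_le.mp (Nat.findGreatest_is_greatest (P := fun y =>
          cornerCount w m y ≤ cornerCount u m y) h1 h2)
      -- Mirror image of the previous case: row `n` is always a zero, so there is a first zero above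
      -- `u j` in column `k`.
      obtain ⟨y₁, ⟨hjy₁, hky₁⟩, hmin⟩ : ∃ y₁ : ℕ, ((u j : ℕ) < y₁ ∧
          cornerCount w k y₁ ≤ cornerCount u k y₁) ∧
          ∀ y < y₁, ¬ ((u j : ℕ) < y ∧ cornerCount w k y ≤ cornerCount u k y) := by
        classical
        have hex : ∃ y₁ : ℕ, (u j : ℕ) < y₁ ∧ cornerCount w k y₁ ≤ cornerCount u k y₁ :=
          ⟨n, (u j).isLt, by rw [cornerCount_top, cornerCount_top]⟩
        exact ⟨Nat.find hex, Nat.find_spec hex, fun y hy => Nat.find_min hex hy⟩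
      have hband : bandCount u k x₀ y₁ < bandCount u m x₀ y₁ := by
        have hyx : x₀ ≤ y₁ := by omega
        have a1 := cornerCount_eq_add u m hyx
        have a2 := cornerCount_eq_add w m hyx
        have a3 := cornerCount_eq_add u k hyx
        have a4 := cornerCount_eq_add w k hyx
        have a5 := bandCount_mono w hmk.le x₀ y₁
        have a6 := hN m y₁
        have a7 := h x₀ (by omega) hx₀j
        omega
      obtain ⟨l, hl1, hl2, hl3, hl4⟩ := exists_of_bandCount_lt hband
      have hlj : l < j := Fin.lt_def.mpr (by omega)
      have hleft : Relation.TransGen (etilde w u) (u i) (u l) := by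
        refine ih i l k (by omega) hik hl1 fun y h1 h2 => ?_
        rcases le_or_gt y (u j) with h3 | h3
        · exact h y h1 h3
        · by_contra hc
          exact hmin y (by omega) ⟨h3, not_lt.mp hc⟩
      refine hleft.trans ?_
      rcases lt_or_gt_of_ne (fun e => hlj.ne (u.injective e) : u l ≠ u j) with h1 | h1
      · exact ih l j m (by omega) hl2 hmj fun y h2 h3 => hmax y (by omega) h3
      · exact transGen_of_inversion huw hlj h1

/-! ### Generators of the cone at `ū`. -/

/-- The indicator vector of a set of coordinates. -/
def indVec (A : Finset (Fin n)) : Fin n → ℝ := fun p => if p ∈ A then 1 else 0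

/-- The vector `e_p - e_q`. -/
def rootVec (p q : Fin n) : Fin n → ℝ := Pi.single p 1 - Pi.single q 1

/-- Exchange the largest `b` of `B \ A` for the largest `a` of `A \ B`. A threshold `z ∈ Z` in `(a,
b]` would give `B` strictly more elements from `z` on than `A`. The exchange keeps the bounds on
`Z`: a count grows only for `b < z ≤ a`, where `B` had strictly fewer elements than `A`. -/
theorem indVec_sub_mem (T : AddSubmonoid (Fin n → ℝ)) (Z : Set ℕ) (A B : Finset (Fin n))
    (hcard : A.card = B.card)
    (hZ : ∀ z ∈ Z, (B.filter fun b : Fin n => z ≤ (b : ℕ)).card ≤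
      (A.filter fun a : Fin n => z ≤ (a : ℕ)).card)
    (hT : ∀ a ∈ A, ∀ b ∉ A, (∀ z ∈ Z, ¬ ((a : ℕ) < z ∧ z ≤ b)) → rootVec a b ∈ T) :
    indVec A - indVec B ∈ T := by
  suffices H : ∀ (d : ℕ) (B : Finset (Fin n)), (B \ A).card = d → A.card = B.card →
      (∀ z ∈ Z, (B.filter fun b : Fin n => z ≤ (b : ℕ)).card ≤
      (A.filter fun a : Fin n => z ≤ (a : ℕ)).card) → indVec A - indVec B ∈ T from
    H _ B rfl hcard hZ
  clear hcard hZ B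
  intro d
  induction d with
  | zero =>
    intro B hd hcard _
    have h1 : B ⊆ A := Finset.sdiff_eq_empty_iff_subset.mp (Finset.card_eq_zero.mp hd)
    obtain rfl := Finset.eq_of_subset_of_card_le h1 hcard.le
    simp
  | succ d ih =>
    intro B hd hcard hZ
    have hAB : (A \ B).card = (B \ A).card := by
      have h1 := Finset.card_sdiff_add_card_inter A B
      have h2 := Finset.card_sdiff_add_card_inter B A
      rw [Finset.inter_comm] at h2
      omega
    obtain ⟨b, hb, hbmax⟩ := (B \ A).exists_max_image id (Finset.card_pos.mp (by omega))
    obtain ⟨a, ha, hamax⟩ := (A \ B).exists_max_image id (Finset.card_pos.mp (by omega))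
    simp only [Finset.mem_sdiff, id] at hb hbmax ha hamax
    have hab : a ≠ b := fun e => ha.2 (e ▸ hb.1)
    have hsub : ∀ z : ℕ, (a : ℕ) < z →
        (A.filter fun x : Fin n => z ≤ (x : ℕ)) ⊆ (B.filter fun x : Fin n => z ≤ (x : ℕ)) := by
      intro z hz x hx
      rw [Finset.mem_filter] at hx ⊢
      refine ⟨?_, hx.2⟩
      by_contra hc
      have := Fin.le_def.mp (hamax x ⟨hx.1, hc⟩)
      omega
    have hsub' : ∀ z : ℕ, (b : ℕ) < z →
        (B.filter fun x : Fin n => z ≤ (x : ℕ)) ⊆ (A.filter fun x : Fin n => z ≤ (x : ℕ)) := by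
      intro z hz x hx
      rw [Finset.mem_filter] at hx ⊢
      refine ⟨?_, hx.2⟩
      by_contra hc
      have := Fin.le_def.mp (hbmax x ⟨hx.1, hc⟩)
      omega
    have h1 : rootVec a b ∈ T := by
      refine hT a ha.1 b hb.2 fun z hz hc => (hZ z hz).not_gt (Finset.card_lt_card ?_)
      rw [Finset.ssubset_iff_of_subset (hsub z hc.1)]
      exact ⟨b, by simp [hb.1, hc.2], by simp [hb.2]⟩
    set B' := insert a (B.erase b) with hB'
    have haB : a ∉ B.erase b := by simp [ha.2]
    have hcB' : B'.card = B.card := by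
      rw [hB', Finset.card_insert_of_notMem haB, Finset.card_erase_add_one hb.1]
    have h2 : indVec A - indVec B' ∈ T := by
      refine ih B' ?_ (hcard.trans hcB'.symm) fun z hz => ?_
      · have : B' \ A = (B \ A).erase b := by
          ext x
          simp only [hB', Finset.mem_sdiff, Finset.mem_insert, Finset.mem_erase]
          constructor
          · rintro ⟨rfl | h, h'⟩
            · exact absurd ha.1 h'
            · exact ⟨h.1, h.2, h'⟩
          · rintro ⟨h, h', h''⟩
            exact ⟨Or.inr ⟨h, h'⟩, h''⟩
        rw [this, Finset.card_erase_of_mem (by simp [hb]), hd]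
        rfl
      · have hf : (B'.filter fun x : Fin n => z ≤ (x : ℕ)).card + (if z ≤ (b : ℕ) then 1 else 0) =
            (B.filter fun x : Fin n => z ≤ (x : ℕ)).card + if z ≤ (a : ℕ) then 1 else 0 := by
          rw [Finset.card_filter, Finset.card_filter, hB', Finset.sum_insert haB,
            ← Finset.add_sum_erase B _ hb.1]
          ring
        have hz' := hZ z hz
        by_cases hza : z ≤ (a : ℕ) <;> by_cases hzb : z ≤ (b : ℕ)
        · simp only [hza, hzb, if_true] at hf
          omega
        · simp only [hza, hzb, if_true, if_false] at hf
          have : (B.filter fun x : Fin n => z ≤ (x : ℕ)).card <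
              (A.filter fun x : Fin n => z ≤ (x : ℕ)).card := by
            refine Finset.card_lt_card ?_
            rw [Finset.ssubset_iff_of_subset (hsub' z (by omega))]
            exact ⟨a, by simp [ha.1, hza], by simp [ha.2]⟩
          omega
        · simp only [hza, hzb, if_true, if_false] at hf
          omega
        · simp only [hza, hzb, if_false] at hf
          omega
    have h3 : indVec A - indVec B = rootVec a b + (indVec A - indVec B') := by
      have : indVec B' = indVec B + rootVec a b := by
        funext p
        simp only [indVec, rootVec, hB', Pi.add_apply, Pi.sub_apply, Pi.single_apply,
          Finset.mem_insert, Finset.mem_erase]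
        by_cases hpa : p = a
        · subst hpa
          simp [ha.2, hab]
        · by_cases hpb : p = b
          · subst hpb
            simp [hb.1, hpa]
          · simp [hpa, hpb]
      rw [this]
      abel
    rw [h3]
    exact T.add_mem h1 h2

/-- The set of the first `k` values of `u`. -/
def firstValues (u : Perm (Fin n)) (k : ℕ) : Finset (Fin n) :=
  (Finset.univ.filter fun i : Fin n => (i : ℕ) < k).map u.toEmbedding

theorem mem_firstValues {u : Perm (Fin n)} {k : ℕ} {p : Fin n} :
    p ∈ firstValues u k ↔ ((u⁻¹ p : Fin n) : ℕ) < k := by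
  simp only [firstValues, Finset.mem_map, Finset.mem_filter, Finset.mem_univ, true_and]
  constructor
  · rintro ⟨i, hi, rfl⟩
    simpa using hi
  · intro h
    exact ⟨u⁻¹ p, h, by simp⟩

theorem card_filter_firstValues (u : Perm (Fin n)) (k x : ℕ) :
    ((firstValues u k).filter fun a : Fin n => x ≤ (a : ℕ)).card = cornerCount u k x := by
  rw [firstValues, Finset.filter_map, Finset.card_map, cornerCount, Finset.filter_filter]
  rfl

theorem ubar_sub_ubar (u v : Perm (Fin n)) :
    ubar v - ubar u =
      ∑ k ∈ Finset.range (n + 1), (indVec (firstValues u k) - indVec (firstValues v k)) := by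
  -- The value `p` is among the first `k` for the `n - v⁻¹ p` thresholds `k` in `(v⁻¹ p, n]`; the `+
  -- 1` offsets the shift in `permPoint`.
  have h : ∀ (v : Perm (Fin n)) (p : Fin n),
      ∑ k ∈ Finset.range (n + 1), indVec (firstValues v k) p = n + 1 - ubar v p := by
    intro v p
    have : (Finset.range (n + 1)).filter (fun k => ((v⁻¹ p : Fin n) : ℕ) < k) =
        Finset.Ioc ((v⁻¹ p : Fin n) : ℕ) n := by
      ext k
      simp only [Finset.mem_filter, Finset.mem_range, Finset.mem_Ioc]
      omega
    simp only [indVec, mem_firstValues, ubar, permPoint]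
    rw [Finset.sum_boole, this, Nat.card_Ioc, Nat.cast_sub (v⁻¹ p).isLt.le]
    ring
  funext p
  rw [Finset.sum_sub_distrib, Pi.sub_apply, Pi.sub_apply, Finset.sum_apply, Finset.sum_apply,
    h, h]
  ring

theorem rootVec_mem_of_transGen {R : Fin n → Fin n → Prop} {T : AddSubmonoid (Fin n → ℝ)}
    (hT : ∀ p q, R p q → rootVec p q ∈ T) {p q : Fin n} (h : Relation.TransGen R p q) :
    rootVec p q ∈ T := by
  induction h with
  | single h => exact hT _ _ h
  | @tail a b _ h ih =>
    have : rootVec p b = rootVec p a + rootVec a b := by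
      simp only [rootVec]
      abel
    rw [this]
    exact T.add_mem ih (hT _ _ h)

/-- The difference of `v̄` and `ū` is a sum of directions `e_p - e_q` of edges of the transitive
reduction. -/
theorem ubar_sub_ubar_mem {w u v : Perm (Fin n)} (huw : bruhatLE u w) (hvw : bruhatLE v w)
    {T : AddSubmonoid (Fin n → ℝ)} (hT : ∀ p q, eset w u p q → rootVec p q ∈ T) :
    ubar v - ubar u ∈ T := by
  rw [ubar_sub_ubar]
  refine T.sum_mem fun k _ => ?_
  -- At these tight thresholds `u` attains the bound set by `w`, so every `v ≤ w` is dominated by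
  -- `u` there.
  refine indVec_sub_mem T {z | cornerCount w k z ≤ cornerCount u k z} _ _ ?_ ?_ ?_
  · simp [firstValues]
  · intro z hz
    rw [card_filter_firstValues, card_filter_firstValues]
    exact (cornerCount_le_of_bruhatLE hvw k z).trans hz
  · intro a ha b hb hz
    rw [mem_firstValues] at ha hb
    refine rootVec_mem_of_transGen hT ?_
    unfold eset
    rw [transGen_transRed_iff _ (etilde_acyclic w u)]
    have := transGen_of_exchange huw ha (not_lt.mp hb) (fun x h1 h2 => ?_)
    · simpa using this
    · by_contra hc
      exact hz x (not_lt.mp hc) ⟨by simpa using h1, by simpa using h2⟩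

/-! ### Ascending paths and the acyclic order on them. -/

open Relation

/-- A relation on a finite type is acyclic if it is irreflexive and if elements of least rank can
be bypassed. -/
theorem transGen_irrefl_of_bypass {α : Type*} {r : α → α → Prop} {m : ℕ} (τ : α → Fin m)
    (hτ : Function.Injective τ) (hirr : ∀ a, ¬ r a a)
    (hr : ∀ a b c, r a b → r b c → τ b < τ a → τ b < τ c → r a c) (a : α) :
    ¬ TransGen r a a := by
  have key : ∀ k : ℕ, ∀ a b, k ≤ (τ a : ℕ) → k ≤ (τ b : ℕ) → TransGen r a b →
      TransGen (fun x y => r x y ∧ k ≤ (τ x : ℕ) ∧ k ≤ (τ y : ℕ)) a b := by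
    intro k
    induction k with
    | zero => intro a b _ _ h; simpa using h
    | succ k ih =>
      intro a b ha hb h
      have h' := ih a b (by omega) (by omega) h
      -- At an element of rank `k` the invariant retains its predecessor `d`, so that the next step
      -- can bypass that element.
      suffices H : (k < (τ b : ℕ) → TransGen (fun x y => r x y ∧ k + 1 ≤ (τ x : ℕ) ∧
            k + 1 ≤ (τ y : ℕ)) a b) ∧
          ((τ b : ℕ) = k → ∃ d, ReflTransGen (fun x y => r x y ∧ k + 1 ≤ (τ x : ℕ) ∧
            k + 1 ≤ (τ y : ℕ)) a d ∧ r d b ∧ k < (τ d : ℕ)) from H.1 hb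
      clear h hb
      induction h' with
      | single h => exact ⟨fun hb => .single ⟨h.1, ha, hb⟩, fun _ => ⟨a, .refl, h.1, ha⟩⟩
      | @tail c b _ h ih' =>
        rcases eq_or_lt_of_le h.2.1 with hc | hc
        · obtain ⟨d, h1, h2, h3⟩ := ih'.2 hc.symm
          constructor
          · intro hb
            refine TransGen.tail' h1 ⟨hr d c b h2 h.1 ?_ ?_, h3, hb⟩ <;>
              rw [Fin.lt_def] <;> omega
          · intro hb
            obtain rfl : c = b := hτ (Fin.ext (hc.symm.trans hb.symm))
            exact absurd h.1 (hirr c)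
        · have h1 := ih'.1 hc
          exact ⟨fun hb => h1.tail ⟨h.1, hc, hb⟩, fun _ => ⟨c, h1.to_reflTransGen, h.1, hc⟩⟩
  suffices H : ∀ (d : ℕ) (a : α), m - (τ a : ℕ) ≤ d → ¬ TransGen r a a from H _ a le_rfl
  intro d
  induction d with
  | zero =>
    intro a ha
    have := (τ a).isLt
    omega
  | succ d ih =>
    intro a ha h
    -- A cycle through `a` can be taken with all ranks at least that of `a`. Bypassing `a` then
    -- leaves a cycle through an element of larger rank.
    have hle := key _ a a le_rfl le_rfl h
    obtain ⟨c, h1, h2⟩ := TransGen.head'_iff.mp hle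
    have hlt : ∀ {c}, (τ a : ℕ) ≤ τ c → c ≠ a → τ a < τ c := fun {c} h1 h2 =>
      lt_of_le_of_ne h1 fun e => h2 (hτ e.symm)
    have hca : c ≠ a := by
      rintro rfl
      exact hirr _ h1.1
    have hac := hlt h1.2.2 hca
    rcases ReflTransGen.cases_tail_iff _ _ _ |>.mp h2 with e | ⟨b, h3, h4⟩
    · exact hca e.symm
    · have hba : b ≠ a := by
        rintro rfl
        exact hirr _ h4.1
      have hab := hlt h4.2.1 hba
      refine ih c ?_ (TransGen.tail' (ReflTransGen.mono (fun _ _ h => h.1) _ _ h3)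
        (hr b a c h4.1 h1.1 hab hac))
      have := Fin.lt_def.mp hac
      omega

/-- The step relation of the ascending paths, on positions. -/
def ascStep (w u : Perm (Fin n)) (i j : Fin n) : Prop := eplus w u (u i) (u j)

theorem ascStep.lt {w u : Perm (Fin n)} {i j : Fin n} (h : ascStep w u i j) : i < j := by
  simpa using lt_of_etilde h.1.1

theorem ascStep.apply_lt {w u : Perm (Fin n)} {i j : Fin n} (h : ascStep w u i j) : u i < u j :=
  h.2

theorem ascStep.not_lt {w u : Perm (Fin n)} {i j : Fin n} (h : ascStep w u i j) {m : Fin n}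
    (h1 : i < m) (h2 : m < j) (h3 : u i < u m) : ¬ u m < u j :=
  not_lt_of_etilde h.1.1 h.2 h1 h2 h3

/-- If `i < j` both step to `k`, emptiness of the rectangle from `i` to `k` makes `(i, j)` an
inversion, and the path through `j` makes the edge from `i` redundant. -/
theorem ascStep.left_unique {w u : Perm (Fin n)} (huw : bruhatLE u w) {i j k : Fin n}
    (hi : ascStep w u i k) (hj : ascStep w u j k) : i = j := by
  have H : ∀ {i j}, ascStep w u i k → ascStep w u j k → ¬ i < j := by
    intro i j hi hj hij
    refine hi.1.2 ⟨u j, transGen_of_inversion huw hij ?_, .single hj.1.1⟩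
    by_contra hc
    refine hi.not_lt hij hj.lt (lt_of_le_of_ne (_root_.not_lt.mp hc) ?_) hj.apply_lt
    exact fun e => hij.ne (u.injective e)
  exact le_antisymm (_root_.not_lt.mp (H hj hi)) (_root_.not_lt.mp (H hi hj))

theorem ascStep.right_unique {w u : Perm (Fin n)} (huw : bruhatLE u w) {i j k : Fin n}
    (hj : ascStep w u i j) (hk : ascStep w u i k) : j = k := by
  have H : ∀ {j k}, ascStep w u i j → ascStep w u i k → ¬ j < k := by
    intro j k hj hk hjk
    refine hk.1.2 ⟨u j, .single hj.1.1, transGen_of_inversion huw hjk ?_⟩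
    by_contra hc
    refine hk.not_lt hj.lt hjk hj.apply_lt (lt_of_le_of_ne (_root_.not_lt.mp hc) ?_)
    exact fun e => hjk.ne (u.injective e)
  exact le_antisymm (_root_.not_lt.mp (H hk hj)) (_root_.not_lt.mp (H hj hk))

/-- Two steps do not cross. -/
theorem ascStep.not_cross {w u : Perm (Fin n)} (huw : bruhatLE u w) {a a' b b' : Fin n}
    (ha : ascStep w u a a') (hb : ascStep w u b b') (h1 : a < b) (h2 : u b < u a)
    (h3 : b' < a') : ¬ u a' < u b' := fun h4 =>
  ha.1.2 ⟨u b, transGen_of_inversion huw h1 h2,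
    .head hb.1.1 (transGen_of_inversion huw h3 h4)⟩

/-- An inversion between two chains survives advancing one or both points. Otherwise the emptiness
of the two step rectangles forces the configuration ruled out by `ascStep.not_cross`. -/
theorem ascStep.advance {w u : Perm (Fin n)} (huw : bruhatLE u w) {a a' b b' : Fin n}
    (ha : ascStep w u a a') (hb : ascStep w u b b') (h1 : a < b) (h2 : u b < u a) :
    (a' < b ∧ u b < u a') ∨ (a < b' ∧ u b' < u a) ∨ (a' < b' ∧ u b' < u a') := by
  have c1 := ha.not_cross huw hb h1 h2
  have c2 := @ascStep.not_lt _ _ _ _ _ ha b'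
  have c3 := @ascStep.not_lt _ _ _ _ _ hb a'
  have a1 := ha.lt
  have a2 := ha.apply_lt
  have b1 := hb.lt
  have b2 := hb.apply_lt
  have e1 : u a' = u b → a' = b := fun h => u.injective h
  have e2 : u a' = u b' → a' = b' := fun h => u.injective h
  have e3 : u a = u b' → a = b' := fun h => u.injective h
  have e4 : a' = b' → a = b := by
    rintro rfl
    exact ha.left_unique huw hb
  have e5 : a' = b → u a' = u b := fun h => congrArg u h
  grind

theorem apply_le_of_ascPath {w u : Perm (Fin n)} {i j : Fin n}
    (h : ReflTransGen (ascStep w u) i j) : i ≤ j ∧ u i ≤ u j := by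
  induction h with
  | refl => exact ⟨le_rfl, le_rfl⟩
  | tail _ h ih => exact ⟨ih.1.trans h.lt.le, ih.2.trans h.apply_lt.le⟩

/-- Advancing the inversion along the chains must end with the chain whose end is further left at
that end, so this end takes part in an inversion with the other chain. -/
theorem ascPath_sweep {w u : Perm (Fin n)} (huw : bruhatLE u w) {a b s t : Fin n}
    (ha : ReflTransGen (ascStep w u) a s) (hb : ReflTransGen (ascStep w u) b t)
    (h1 : a < b) (h2 : u b < u a) :
    (t < s → ∃ a', ReflTransGen (ascStep w u) a' s ∧ a' < t ∧ u t < u a') ∧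
    (s < t → ∃ b', ReflTransGen (ascStep w u) b' t ∧ s < b' ∧ u b' < u s) := by
  suffices H : ∀ (d : ℕ) (a b : Fin n), 2 * n - ((a : ℕ) + b) ≤ d →
      ReflTransGen (ascStep w u) a s → ReflTransGen (ascStep w u) b t → a < b → u b < u a →
      (t < s → ∃ a', ReflTransGen (ascStep w u) a' s ∧ a' < t ∧ u t < u a') ∧
      (s < t → ∃ b', ReflTransGen (ascStep w u) b' t ∧ s < b' ∧ u b' < u s) from
    H _ a b le_rfl ha hb h1 h2
  intro d
  induction d with
  | zero =>
    intro a b hd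
    have := a.isLt
    have := b.isLt
    omega
  | succ d ih =>
    intro a b hd ha hb h1 h2
    rcases ha.cases_head with rfl | ⟨a', haa', ha's⟩
    · refine ⟨fun h => ?_, fun _ => ⟨b, hb, h1, h2⟩⟩
      exact absurd ((apply_le_of_ascPath hb).1.trans_lt h) h1.not_gt
    have p1 := Fin.lt_def.mp haa'.lt
    rcases hb.cases_head with rfl | ⟨b', hbb', hb't⟩
    · refine ⟨fun _ => ⟨a, ha, h1, h2⟩, fun h => ?_⟩
      exact ih a' b (by omega) ha's hb ((apply_le_of_ascPath ha's).1.trans_lt h)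
        (h2.trans haa'.apply_lt) |>.2 h
    have p2 := Fin.lt_def.mp hbb'.lt
    rcases haa'.advance huw hbb' h1 h2 with h | h | h
    · exact ih a' b (by omega) ha's hb h.1 h.2
    · exact ih a b' (by omega) ha hb't h.1 h.2
    · exact ih a' b' (by omega) ha's hb't h.1 h.2

theorem ascGraph_adj {w u : Perm (Fin n)} {i j : Fin n} :
    (ascGraph w u).Adj i j ↔ ascStep w u i j ∨ ascStep w u j i := by
  rw [ascGraph, SimpleGraph.fromRel_adj]
  refine ⟨fun h => h.2, fun h => ⟨?_, h⟩⟩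
  rcases h with h | h
  · exact h.lt.ne
  · exact h.lt.ne'

theorem ascentOf_eq_of_ascStep {w u : Perm (Fin n)} {i j : Fin n} (h : ascStep w u i j) :
    ascentOf w u i = ascentOf w u j :=
  SimpleGraph.ConnectedComponent.connectedComponentMk_eq_of_adj (ascGraph_adj.mpr (.inl h))

theorem ascentOf_eq_of_ascPath {w u : Perm (Fin n)} {i j : Fin n}
    (h : ReflTransGen (ascStep w u) i j) : ascentOf w u i = ascentOf w u j := by
  induction h with
  | refl => rfl
  | tail _ h ih => exact ih.trans (ascentOf_eq_of_ascStep h)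

theorem ascPath_or_ascPath_of_ascentOf_eq {w u : Perm (Fin n)} (huw : bruhatLE u w)
    {i j : Fin n} (h : ascentOf w u i = ascentOf w u j) :
    ReflTransGen (ascStep w u) i j ∨ ReflTransGen (ascStep w u) j i := by
  obtain ⟨p⟩ := SimpleGraph.ConnectedComponent.exact h
  induction p with
  | nil => exact .inl .refl
  | @cons a b c hadj _ ih =>
    have hbc : ascentOf w u b = ascentOf w u c :=
      (SimpleGraph.ConnectedComponent.connectedComponentMk_eq_of_adj hadj).symm.trans h
    rcases ascGraph_adj.mp hadj with hab | hba <;> rcases ih hbc with h1 | h1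
    · exact .inl (h1.head hab)
    · rcases ReflTransGen.cases_tail_iff _ _ _ |>.mp h1 with rfl | ⟨x, h2, h3⟩
      · exact .inl (.single hab)
      · obtain rfl := h3.left_unique huw hab
        exact .inr h2
    · rcases h1.cases_head with rfl | ⟨x, h2, h3⟩
      · exact .inr (.single hba)
      · obtain rfl := h2.right_unique huw hba
        exact .inl h3
    · exact .inr (h1.tail hba)

theorem exists_ascent_top {w u : Perm (Fin n)} (huw : bruhatLE u w)
    (C : (ascGraph w u).ConnectedComponent) :
    ∃ t, ascentOf w u t = C ∧ ∀ i, ascentOf w u i = C → ReflTransGen (ascStep w u) i t := by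
  classical
  obtain ⟨i₀, hi₀⟩ : ∃ i, ascentOf w u i = C := C.exists_rep
  obtain ⟨t, ht, hmax⟩ := (Finset.univ.filter fun i => ascentOf w u i = C).exists_max_image id
    ⟨i₀, by simpa using hi₀⟩
  simp only [Finset.mem_filter, Finset.mem_univ, true_and, id] at ht hmax
  refine ⟨t, ht, fun i hi => ?_⟩
  rcases ascPath_or_ascPath_of_ascentOf_eq huw (hi.trans ht.symm) with h | h
  · exact h
  · rw [le_antisymm (hmax i hi) (apply_le_of_ascPath h).1]

/-- Some position of the maximal ascent `C` lies to the left of one of `D` and has a larger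
value. -/
def ascentAbove (w u : Perm (Fin n)) (C D : (ascGraph w u).ConnectedComponent) : Prop :=
  ∃ i j : Fin n, ascentOf w u i = C ∧ ascentOf w u j = D ∧ i < j ∧ u j < u i

theorem ascentAbove_acyclic {w u : Perm (Fin n)} (huw : bruhatLE u w)
    (C : (ascGraph w u).ConnectedComponent) : ¬ TransGen (ascentAbove w u) C C := by
  choose τ hτ hpath using exists_ascent_top huw
  refine transGen_irrefl_of_bypass τ (fun C D h => by rw [← hτ C, ← hτ D, h]) ?_ ?_ C
  · rintro C ⟨i, j, hi, hj, hij, hu⟩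
    rcases ascPath_or_ascPath_of_ascentOf_eq huw (hi.trans hj.symm) with h | h
    · exact hu.not_ge (apply_le_of_ascPath h).2
    · exact hij.not_ge (apply_le_of_ascPath h).1
  · rintro A B C ⟨a, b, ha, hb, hab, hu⟩ ⟨b', c, hb', hc, hbc, hu'⟩ hA hC
    -- The top of `B` lies to the left of those of `A` and `C`, so both inversions can be moved to
    -- that top, where they compose.
    obtain ⟨a', h1, h2, h3⟩ := (ascPath_sweep huw (hpath A a ha) (hpath B b hb) hab hu).1 hA
    obtain ⟨c', h4, h5, h6⟩ := (ascPath_sweep huw (hpath B b' hb') (hpath C c hc) hbc hu').2 hC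
    exact ⟨a', c', (ascentOf_eq_of_ascPath h1).trans (hτ A),
      (ascentOf_eq_of_ascPath h4).trans (hτ C), h2.trans h5, h6.trans h3⟩

/-- A finite acyclic relation is compatible with an injective real function. -/
theorem exists_injective_real_of_acyclic {α : Type*} [Finite α] {r : α → α → Prop}
    (hr : ∀ a, ¬ TransGen r a a) :
    ∃ f : α → ℝ, Function.Injective f ∧ ∀ a b, r a b → f b < f a := by
  classical
  let P : PartialOrder α :=
    -- The order is reversed so that `r a b` puts `b` below `a`.
    { le := fun a b => ReflTransGen r b a
      le_refl := fun _ => .refl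
      le_trans := fun _ _ _ h1 h2 => h2.trans h1
      le_antisymm := fun a b h1 h2 => by
        rcases reflTransGen_iff_eq_or_transGen.mp h1 with h | h
        · exact h
        · exact absurd (h.trans_left h2) (hr b) }
  have : Countable (LinearExtension α) := Finite.to_countable (α := α)
  obtain ⟨g⟩ := Order.embedding_from_countable_to_dense (LinearExtension α) ℝ
  refine ⟨fun a => g (toLinearExtension a), fun a b h => g.injective h, fun a b h => ?_⟩
  rw [g.lt_iff_lt]
  refine lt_of_le_of_ne (toLinearExtension.monotone (ReflTransGen.single h)) fun e => ?_
  have e' : b = a := e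
  subst e'
  exact hr b (.single h)

theorem exists_ascent_function {w u : Perm (Fin n)} (huw : bruhatLE u w) :
    ∃ f : (ascGraph w u).ConnectedComponent → ℝ, Function.Injective f ∧
      ∀ i j : Fin n, i < j → u j < u i → f (ascentOf w u j) < f (ascentOf w u i) := by
  obtain ⟨f, hf, h⟩ := exists_injective_real_of_acyclic (ascentAbove_acyclic huw)
  exact ⟨f, hf, fun i j hij hu => h _ _ ⟨i, j, rfl, rfl, hij, hu⟩⟩

/-! ### Cones and faces of polytopes. -/

open scoped NNReal

section Polytope

variable {E : Type*} [AddCommGroup E] [Module ℝ E]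

/-- In a nonnegative combination of generators no cancellation occurs under `g`. The second half
extracts a generator lying along a face from any nonzero vector along that face. -/
theorem nonneg_and_exists_of_mem_span {S : Set E} (g : E →ₗ[ℝ] ℝ) (hg : ∀ s ∈ S, 0 ≤ g s) {x : E}
    (hx : x ∈ Submodule.span ℝ≥0 S) : 0 ≤ g x ∧ (g x = 0 → x ≠ 0 → ∃ s ∈ S, g s = 0) := by
  induction hx using Submodule.span_induction with
  | mem x hx => exact ⟨hg x hx, fun h _ => ⟨x, hx, h⟩⟩
  | zero => exact ⟨by simp, fun _ h => absurd rfl h⟩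
  | add x y _ _ ihx ihy =>
    rw [map_add]
    refine ⟨add_nonneg ihx.1 ihy.1, fun h hxy => ?_⟩
    by_cases h0 : x = 0
    · subst h0
      exact ihy.2 (by simpa using h) (by simpa using hxy)
    · exact ihx.2 (by linarith [ihx.1, ihy.1]) h0
  | smul a x _ ih =>
    rw [NNReal.smul_def, map_smul, smul_eq_mul]
    refine ⟨mul_nonneg a.2 ih.1, fun h hx => ?_⟩
    have ha : (a : ℝ) ≠ 0 := fun h0 => hx (by rw [h0, zero_smul])
    exact ih.2 ((mul_eq_zero.mp h).resolve_left ha) fun h0 => hx (by rw [h0, smul_zero])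

theorem sub_mem_span_of_mem_convexHull {S V : Set E} {u : E}
    (h : ∀ v ∈ V, v - u ∈ Submodule.span ℝ≥0 S) {x : E} (hx : x ∈ convexHull ℝ V) :
    x - u ∈ Submodule.span ℝ≥0 S := by
  have hc : Convex ℝ {x | x - u ∈ Submodule.span ℝ≥0 S} := by
    intro x hx y hy a b ha hb hab
    have e : a • x + b • y - u = (⟨a, ha⟩ : ℝ≥0) • (x - u) + (⟨b, hb⟩ : ℝ≥0) • (y - u) := by
      change _ = a • (x - u) + b • (y - u)
      rw [smul_sub, smul_sub]
      have : u = a • u + b • u := by rw [← add_smul, hab, one_smul]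
      nth_rewrite 1 [this]
      abel
    rw [Set.mem_ofPred_eq, e]
    exact Submodule.add_mem _ (Submodule.smul_mem _ _ hx) (Submodule.smul_mem _ _ hy)
  exact convexHull_min h hc hx

/-- An exposed face of an exposed face of a polytope is an exposed face. -/
theorem IsExposed.trans_of_finite [TopologicalSpace E] [ContinuousAdd E]
    [ContinuousConstSMul ℝ E] {V : Set E} (hV : V.Finite)
    {G e : Set E} (hG : IsExposed ℝ (convexHull ℝ V) G) (he : IsExposed ℝ G e) :
    IsExposed ℝ (convexHull ℝ V) e := by
  intro hne
  obtain ⟨l₂, hl₂⟩ := he hne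
  obtain ⟨x₀, hx₀⟩ := hne
  have hx₀G : x₀ ∈ G := he.subset hx₀
  obtain ⟨l₁, hl₁⟩ := hG ⟨x₀, hx₀G⟩
  have hx₀Q : x₀ ∈ convexHull ℝ V := hG.subset hx₀G
  have m₁ : ∀ y ∈ convexHull ℝ V, l₁ y ≤ l₁ x₀ := by
    rw [hl₁] at hx₀G
    exact hx₀G.2
  have m₂ : ∀ y ∈ G, l₂ y ≤ l₂ x₀ := by
    rw [hl₂] at hx₀
    exact hx₀.2
  have memG : ∀ x ∈ convexHull ℝ V, l₁ x = l₁ x₀ → x ∈ G := fun x hx h => by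
    rw [hl₁]
    exact ⟨hx, fun y hy => (m₁ y hy).trans h.ge⟩
  -- Vertices outside `G` have a positive gap in `l₁`; as there are finitely many, a single large
  -- `N` outweighs `l₂` on all of them.
  obtain ⟨N, hN⟩ : ∃ N : ℝ, ∀ v ∈ V, N * l₁ v + l₂ v ≤ N * l₁ x₀ + l₂ x₀ := by
    have hex : ∀ v ∈ V, ∃ N : ℝ, ∀ M ≥ N, M * l₁ v + l₂ v ≤ M * l₁ x₀ + l₂ x₀ := by
      intro v hv
      have hvQ := subset_convexHull ℝ V hv
      rcases eq_or_lt_of_le (m₁ v hvQ) with h | h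
      · refine ⟨0, fun M _ => ?_⟩
        have := m₂ v (memG v hvQ h)
        rw [h]
        linarith
      · refine ⟨(l₂ v - l₂ x₀) / (l₁ x₀ - l₁ v), fun M hM => ?_⟩
        rw [ge_iff_le, div_le_iff₀ (by linarith)] at hM
        linarith
    choose! N hN using hex
    obtain ⟨M, hM⟩ := (hV.image N).bddAbove
    exact ⟨M, fun v hv => hN v hv M (hM ⟨v, hv, rfl⟩)⟩
  have hQ : ∀ y ∈ convexHull ℝ V, N * l₁ y + l₂ y ≤ N * l₁ x₀ + l₂ x₀ := by
    intro y hy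
    have hc : Convex ℝ {y | (N • l₁ + l₂) y ≤ N * l₁ x₀ + l₂ x₀} :=
      convex_halfSpace_le (N • l₁ + l₂).toLinearMap.isLinear _
    exact convexHull_min (fun v hv => by simpa using hN v hv) hc hy
  -- The extra `l₁` forces every maximizer to maximize `l₁`, hence to lie in `G`.
  refine ⟨(N + 1) • l₁ + l₂, ?_⟩
  ext x
  simp only [Set.mem_ofPred_eq, _root_.add_apply, _root_.smul_apply,
    smul_eq_mul]
  constructor
  · intro hx
    have hxG := he.subset hx
    refine ⟨hG.subset hxG, fun y hy => ?_⟩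
    have h1 : l₁ x = l₁ x₀ := by
      rw [hl₁] at hxG
      exact le_antisymm (m₁ x hxG.1) (hxG.2 x₀ hx₀Q)
    have h2 : l₂ x = l₂ x₀ := by
      rw [hl₂] at hx
      exact le_antisymm (m₂ x hx.1) (hx.2 x₀ hx₀G)
    rw [h1, h2]
    linarith [hQ y hy, m₁ y hy]
  · rintro ⟨hxQ, hx⟩
    have h0 := hx x₀ hx₀Q
    have h1 := hQ x hxQ
    have h2 := m₁ x hxQ
    have h3 : l₁ x = l₁ x₀ := by linarith
    have hxG := memG x hxQ h3
    have h4 : l₂ x = l₂ x₀ := by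
      have := m₂ x hxG
      rw [h3] at h0
      linarith
    rw [hl₂]
    exact ⟨hxG, fun y hy => (m₂ y hy).trans h4.ge⟩

end Polytope

/-! ### The polytope near `ū` and its edges there. -/

/-- The linear form `x ↦ ∑ k, c k * x k`. -/
noncomputable def weightForm (c : Fin n → ℝ) : StrongDual ℝ (Fin n → ℝ) :=
  ∑ k, c k • ContinuousLinearMap.proj (R := ℝ) (φ := fun _ : Fin n => ℝ) k

theorem weightForm_apply (c x : Fin n → ℝ) : weightForm c x = ∑ k, c k * x k := by
  simp [weightForm]

theorem weightForm_rootVec (c : Fin n → ℝ) (p q : Fin n) :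
    weightForm c (rootVec p q) = c p - c q := by
  simp [weightForm_apply, rootVec, mul_sub, Finset.sum_sub_distrib, Pi.single_apply]

theorem rootVec_ne_zero {p q : Fin n} (h : p ≠ q) : rootVec p q ≠ 0 := by
  intro h0
  have := congrFun h0 p
  simp [rootVec, h] at this

/-- The directions of the edges of the transitive reduction. -/
def edgeDirections (w u : Perm (Fin n)) : Set (Fin n → ℝ) :=
  {x | ∃ p q, eset w u p q ∧ x = rootVec p q}

theorem bruhatPolytope_one_inv (w : Perm (Fin n)) :
    bruhatPolytope 1 w⁻¹ = convexHull ℝ (ubar '' {v | bruhatLE v w}) := by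
  rw [bruhatPolytope]
  congr 1
  ext x
  constructor
  · rintro ⟨z, ⟨-, hz⟩, rfl⟩
    exact ⟨z⁻¹, by simpa using hz.inv, by simp [ubar]⟩
  · rintro ⟨v, hv, rfl⟩
    exact ⟨v⁻¹, ⟨one_bruhatLE _, bruhatLE.inv hv⟩, rfl⟩

theorem ubar_mem {w v : Perm (Fin n)} (hv : bruhatLE v w) : ubar v ∈ bruhatPolytope 1 w⁻¹ := by
  rw [bruhatPolytope_one_inv]
  exact subset_convexHull _ _ ⟨v, hv, rfl⟩

theorem sub_ubar_mem_span {w u : Perm (Fin n)} (huw : bruhatLE u w) {x : Fin n → ℝ}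
    (hx : x ∈ bruhatPolytope 1 w⁻¹) :
    x - ubar u ∈ Submodule.span ℝ≥0 (edgeDirections w u) := by
  rw [bruhatPolytope_one_inv] at hx
  refine sub_mem_span_of_mem_convexHull ?_ hx
  rintro _ ⟨v, hv, rfl⟩
  exact ubar_sub_ubar_mem (T := (Submodule.span ℝ≥0 (edgeDirections w u)).toAddSubmonoid) huw hv
    fun p q h => Submodule.subset_span ⟨p, q, h, rfl⟩

theorem ubar_mul_swap (u : Perm (Fin n)) (i j : Fin n) :
    ubar (u * swap i j) = ubar u + ((j : ℝ) - i) • rootVec (u i) (u j) := by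
  funext k
  obtain ⟨m, rfl⟩ := u.surjective k
  simp only [ubar, permPoint, mul_inv_rev, swap_inv, Perm.mul_apply, Pi.add_apply, Pi.smul_apply,
    rootVec, Pi.sub_apply, Pi.single_apply, EmbeddingLike.apply_eq_iff_eq, smul_eq_mul]
  have hm : u⁻¹ (u m) = m := by simp
  rw [hm]
  by_cases h1 : m = i
  · subst h1
    by_cases h2 : m = j
    · subst h2
      simp
    · simp [h2]
      ring
  · by_cases h2 : m = j
    · subst h2
      simp [h1]
      ring
    · simp [h1, h2, swap_apply_of_ne_of_ne]

theorem exists_add_smul_mem {w u : Perm (Fin n)} {s : Fin n → ℝ} (hs : s ∈ edgeDirections w u) :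
    ∃ c : ℝ, 0 < c ∧ ubar u + c • s ∈ bruhatPolytope 1 w⁻¹ := by
  obtain ⟨p, q, h, rfl⟩ := hs
  obtain ⟨i, j, hij, rfl, rfl, hw, -⟩ := h.1
  refine ⟨(j : ℝ) - i, by simpa using hij, ?_⟩
  rw [← ubar_mul_swap, mul_swap_eq_swap_mul]
  exact ubar_mem hw

/-- Edges of the digraph run from left to right in `u`. A form strictly negative on all generators
makes the cone pointed, so `ū` is a vertex. -/
theorem weightForm_position_neg {w u : Perm (Fin n)} {s : Fin n → ℝ}
    (hs : s ∈ edgeDirections w u) :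
    weightForm (fun k => ((u⁻¹ k : Fin n) : ℝ)) s < 0 := by
  obtain ⟨p, q, h, rfl⟩ := hs
  rw [weightForm_rootVec]
  have := Fin.lt_def.mp (lt_of_etilde h.1)
  have h' : (((u⁻¹ p : Fin n) : ℕ) : ℝ) < ((u⁻¹ q : Fin n) : ℕ) := by exact_mod_cast this
  linarith

theorem ubar_mem_extremePoints {w u : Perm (Fin n)} (huw : bruhatLE u w) :
    ubar u ∈ (bruhatPolytope 1 w⁻¹).extremePoints ℝ := by
  refine exposedPoints_subset_extremePoints
    ⟨ubar_mem huw, weightForm fun k => ((u⁻¹ k : Fin n) : ℝ), fun y hy => ?_⟩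
  set φ := weightForm fun k => ((u⁻¹ k : Fin n) : ℝ) with hφ
  obtain ⟨h1, h2⟩ := nonneg_and_exists_of_mem_span (-φ).toLinearMap
    (fun s hs => neg_nonneg.mpr (weightForm_position_neg hs).le) (sub_ubar_mem_span huw hy)
  simp only [ContinuousLinearMap.coe_coe, _root_.neg_apply, map_sub] at h1 h2
  refine ⟨by linarith, fun h3 => ?_⟩
  by_contra hne
  obtain ⟨s, hs, hs0⟩ := h2 (by linarith) (sub_ne_zero.mpr hne)
  have := weightForm_position_neg hs
  rw [← hφ] at this
  linarith

/-- An edge that emanates from `ū` has the direction of an edge of the transitive reduction. -/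
theorem exists_direction_of_isEdge {w u : Perm (Fin n)} (huw : bruhatLE u w)
    {e : Set (Fin n → ℝ)} (he : IsEdge (bruhatPolytope 1 w⁻¹) e) (hue : ubar u ∈ e) :
    ∃ s ∈ edgeDirections w u, ∃ c : ℝ, 0 < c ∧ ubar u + c • s ∈ e := by
  obtain ⟨l, hl⟩ := he.1 ⟨_, hue⟩
  have hmax : ∀ y ∈ bruhatPolytope 1 w⁻¹, l y ≤ l (ubar u) := by
    rw [hl] at hue
    exact hue.2
  obtain ⟨x, hx, hxu⟩ : ∃ x ∈ e, x ≠ ubar u := by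
    by_contra! hc
    have : e = {ubar u} := Set.eq_singleton_iff_unique_mem.mpr ⟨hue, hc⟩
    have h1 := he.2
    rw [this, vectorSpan_singleton] at h1
    simp at h1
  have hnn : ∀ s ∈ edgeDirections w u, 0 ≤ (-l).toLinearMap s := by
    intro s hs
    obtain ⟨c, hc, hcs⟩ := exists_add_smul_mem hs
    have := hmax _ hcs
    rw [map_add, map_smul, smul_eq_mul] at this
    have h2 : l s ≤ 0 := by
      by_contra h3
      have := mul_pos hc (not_le.mp h3)
      linarith
    simpa using h2
  have hxe := hx
  rw [hl] at hxe
  obtain ⟨s, hs, hs0⟩ := (nonneg_and_exists_of_mem_span _ hnn (sub_ubar_mem_span huw hxe.1)).2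
    (by
      have := hxe.2 _ (ubar_mem huw)
      have := hmax _ hxe.1
      simp only [ContinuousLinearMap.coe_coe, _root_.neg_apply, map_sub]
      linarith) (sub_ne_zero.mpr hxu)
  have hs0' : l s = 0 := by simpa using hs0
  obtain ⟨c, hc, hcs⟩ := exists_add_smul_mem hs
  refine ⟨s, hs, c, hc, ?_⟩
  rw [hl]
  refine ⟨hcs, fun y hy => ?_⟩
  rw [map_add, map_smul, hs0', smul_zero, add_zero]
  exact hmax y hy

/-- An edge that emanates from `ū` is a segment with endpoint `ū`. -/
theorem eq_segment_of_isEdge {w u : Perm (Fin n)} (huw : bruhatLE u w)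
    {e : Set (Fin n → ℝ)} (he : IsEdge (bruhatPolytope 1 w⁻¹) e) (hue : ubar u ∈ e)
    {s : Fin n → ℝ} (hs : s ∈ edgeDirections w u) {c : ℝ} (hc : 0 < c) (hcs : ubar u + c • s ∈ e) :
    ∃ t : ℝ, 0 < t ∧ e = segment ℝ (ubar u) (ubar u + t • s) := by
  set φ := weightForm fun k => ((u⁻¹ k : Fin n) : ℝ) with hφ
  have hφs : φ s < 0 := weightForm_position_neg hs
  have hQ : bruhatPolytope 1 w⁻¹ = convexHull ℝ (ubar '' {v | bruhatLE v w}) :=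
    bruhatPolytope_one_inv w
  have hcomp : IsCompact e := by
    refine he.1.isCompact ?_
    rw [hQ]
    exact (Set.toFinite _).isCompact_convexHull ℝ
  have hconv : Convex ℝ e := he.1.convex (convex_convexHull ℝ _)
  have hs0 : s ≠ 0 := by
    rintro rfl
    simp at hφs
  have hmem : ∀ x ∈ e, x - ubar u ∈ vectorSpan ℝ e := fun x hx => vsub_mem_vectorSpan ℝ hx hue
  have hsv : s ∈ vectorSpan ℝ e := by
    have := hmem _ hcs
    rw [add_sub_cancel_left] at this
    exact (Submodule.smul_mem_iff _ hc.ne').mp this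
  have hline : ∀ x ∈ e, ∃ t : ℝ, 0 ≤ t ∧ x = ubar u + t • s := by
    intro x hx
    obtain ⟨t, ht⟩ := exists_smul_eq_of_finrank_eq_one he.2
      (x := (⟨s, hsv⟩ : vectorSpan ℝ e)) (fun h => hs0 (congrArg Subtype.val h))
      ⟨x - ubar u, hmem x hx⟩
    have ht' : t • s = x - ubar u := congrArg Subtype.val ht
    refine ⟨t, ?_, by rw [ht']; abel⟩
    have h1 := (nonneg_and_exists_of_mem_span (-φ).toLinearMap
      (fun s hs => neg_nonneg.mpr (weightForm_position_neg hs).le)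
      (sub_ubar_mem_span huw (he.1.subset hx))).1
    rw [← ht'] at h1
    simp only [ContinuousLinearMap.coe_coe, _root_.neg_apply, map_smul,
      smul_eq_mul] at h1
    by_contra hneg
    have := mul_pos_of_neg_of_neg (not_le.mp hneg) hφs
    linarith
  -- As `φ s < 0`, minimizing `φ` finds the point of the compact set `e` farthest along the ray from
  -- `ū`.
  obtain ⟨y, hy, hymax⟩ := hcomp.exists_isMinOn ⟨_, hue⟩ φ.continuous.continuousOn
  obtain ⟨t, ht0, rfl⟩ := hline y hy
  have hle : ∀ t' : ℝ, ubar u + t' • s ∈ e → t' ≤ t := by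
    intro t' h
    have := hymax h
    simp only [Set.mem_ofPred_eq, map_add, map_smul, smul_eq_mul] at this
    nlinarith
  have ht : 0 < t := hc.trans_le (hle c hcs)
  refine ⟨t, ht, Set.Subset.antisymm (fun x hx => ?_) (hconv.segment_subset hue hy)⟩
  obtain ⟨t', ht', rfl⟩ := hline x hx
  rw [segment_eq_image']
  refine ⟨t' / t, ⟨by positivity, (div_le_one ht).mpr (hle t' hx)⟩, ?_⟩
  simp only [add_sub_cancel_left, smul_smul, div_mul_cancel₀ _ ht.ne']

end BruhatPolytope

open BruhatPolytope

/-! ### The face `G` and its edges at `ū`. -/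

theorem proposition4p5 (n : ℕ) (w u : Equiv.Perm (Fin n)) (hu : bruhatLE u w) :
    ubar u ∈ (bruhatPolytope 1 w⁻¹).extremePoints ℝ ∧
    -- an injective `f` is the same as a total order on the maximal ascending paths,
    -- together with a strictly increasing real function for that order
    ∃ f : (ascGraph w u).ConnectedComponent → ℝ,
      Function.Injective f ∧
      (∀ i j : Fin n, i < j → u j < u i → f (ascentOf w u j) < f (ascentOf w u i)) ∧
      (∀ x ∈ bruhatPolytope 1 w⁻¹, pathFunctional w u f (ubar u) ≤ pathFunctional w u f x) ∧
      ∃ G : Set (Fin n → ℝ),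
        G = {x ∈ bruhatPolytope 1 w⁻¹ | pathFunctional w u f x = pathFunctional w u f (ubar u)} ∧
        IsExposed ℝ (bruhatPolytope 1 w⁻¹) G ∧
        ubar u ∈ G ∧
        ∀ a : Fin n → ℝ, StrictAnti a →
          {e | IsEdge G e ∧ ubar u ∈ e} =
            ascendingEdges (fun x => ∑ k, a k * x k) (bruhatPolytope 1 w⁻¹) (ubar u) := by
  obtain ⟨f, hf, hlt⟩ := exists_ascent_function hu
  set F := weightForm fun k => f (ascentOf w u (u⁻¹ k)) with hF
  have hFa : ∀ x, pathFunctional w u f x = F x := fun x => (weightForm_apply _ x).symm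
  -- An ascending edge joins two positions of one maximal ascent, which carry the same weight; a
  -- descending edge is an inversion, along which the weight drops.
  have hasc : ∀ p q, eset w u p q → p < q → F (rootVec p q) = 0 := by
    intro p q h hpq
    rw [hF, weightForm_rootVec, sub_eq_zero]
    congr 1
    refine ascentOf_eq_of_ascStep ?_
    have h' : eplus w u p q := ⟨h, hpq⟩
    simpa [ascStep] using h'
  have hdesc : ∀ p q, eset w u p q → q < p → 0 < F (rootVec p q) := by
    intro p q h hpq
    rw [hF, weightForm_rootVec, sub_pos]
    exact hlt _ _ (lt_of_etilde h.1) (by simpa using hpq)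
  have hne : ∀ p q, eset w u p q → p ≠ q := by
    rintro p q h rfl
    exact (lt_of_etilde h.1).false
  have hnn : ∀ s ∈ edgeDirections w u, 0 ≤ F.toLinearMap s := by
    rintro _ ⟨p, q, h, rfl⟩
    rcases lt_or_gt_of_ne (hne p q h) with hpq | hpq
    · exact (hasc p q h hpq).ge
    · exact (hdesc p q h hpq).le
  have hmin : ∀ x ∈ bruhatPolytope 1 w⁻¹, F (ubar u) ≤ F x := by
    intro x hx
    have := (nonneg_and_exists_of_mem_span _ hnn (sub_ubar_mem_span hu hx)).1
    simpa [sub_nonneg] using this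
  have hexp : IsExposed ℝ (bruhatPolytope 1 w⁻¹)
      {x ∈ bruhatPolytope 1 w⁻¹ | pathFunctional w u f x = pathFunctional w u f (ubar u)} := by
    intro _
    refine ⟨-F, ?_⟩
    ext x
    simp only [Set.mem_ofPred_eq, hFa, _root_.neg_apply, neg_le_neg_iff]
    exact and_congr_right fun hx => ⟨fun h y hy => h ▸ hmin y hy,
      fun h => le_antisymm (h _ (ubar_mem hu)) (hmin x hx)⟩
  refine ⟨ubar_mem_extremePoints hu, f, hf, hlt, by simpa only [hFa] using hmin, _, rfl, hexp,
    ⟨ubar_mem hu, rfl⟩, fun a ha => Set.ext fun e => ⟨?_, ?_⟩⟩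
  · rintro ⟨he, hue⟩
    have heQ : IsEdge (bruhatPolytope 1 w⁻¹) e := by
      refine ⟨?_, he.2⟩
      have h1 := hexp
      have h2 := he.1
      rw [bruhatPolytope_one_inv] at h1 h2 ⊢
      exact IsExposed.trans_of_finite (Set.toFinite _) h1 h2
    obtain ⟨s, hs, c, hc, hcs⟩ := exists_direction_of_isEdge hu heQ hue
    obtain ⟨t, ht, rfl⟩ := eq_segment_of_isEdge hu heQ hue hs hc hcs
    refine ⟨heQ, _, rfl, ?_⟩
    have hFs : F s = 0 := by
      have := (he.1.subset hcs).2
      simpa [hFa, hc.ne'] using this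
    obtain ⟨p, q, h, rfl⟩ := hs
    have hpq : p < q := by
      refine lt_of_le_of_ne (not_lt.mp fun hqp => ?_) (hne p q h)
      exact (hdesc p q h hqp).ne' hFs
    simp only [← weightForm_apply]
    rw [map_add, map_smul, weightForm_rootVec, smul_eq_mul]
    have := mul_pos ht (sub_pos.mpr (ha hpq))
    linarith
  · rintro ⟨he, y, rfl, hy⟩
    have hue := left_mem_segment ℝ (ubar u) y
    obtain ⟨s, hs, c, hc, hcs⟩ := exists_direction_of_isEdge hu he hue
    rw [segment_eq_image'] at hcs
    obtain ⟨t, ⟨ht0, -⟩, ht⟩ := hcs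
    have ht' : t • (y - ubar u) = c • s := add_left_cancel ht
    obtain ⟨p, q, h, rfl⟩ := hs
    have htpos : 0 < t := by
      refine lt_of_le_of_ne ht0 fun h0 => ?_
      rw [← h0, zero_smul] at ht'
      exact smul_ne_zero hc.ne' (rootVec_ne_zero (hne p q h)) ht'.symm
    simp only [← weightForm_apply] at hy
    have ha' : 0 < a p - a q := by
      have h1 := congrArg (weightForm a) ht'
      rw [map_smul, map_smul, map_sub, weightForm_rootVec, smul_eq_mul, smul_eq_mul] at h1
      have h2 := mul_pos htpos (sub_pos.mpr hy)
      rw [h1] at h2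
      exact (mul_pos_iff_of_pos_left hc).mp h2
    have hpq : p < q := ha.lt_iff_gt.mp (sub_pos.mp ha')
    -- The direction of the edge is a positive multiple of `e_p - e_q` with `p < q`, so `F` is
    -- constant on the edge and the edge lies in `G`.
    have hFy : F y = F (ubar u) := by
      have h1 := congrArg F ht'
      rw [map_smul, map_smul, map_sub, hasc p q h hpq, smul_zero, smul_eq_mul] at h1
      exact sub_eq_zero.mp ((mul_eq_zero.mp h1).resolve_left htpos.ne')
    refine ⟨⟨he.1.mono (fun x hx => hx.1) fun x hx => ⟨he.1.subset hx, ?_⟩, he.2⟩, hue⟩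
    rw [segment_eq_image'] at hx
    obtain ⟨r, -, rfl⟩ := hx
    rw [hFa, hFa, map_add, map_smul, map_sub, hFy, sub_self, smul_zero, add_zero]
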